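/- Let $d\ge 1$ and let $\Omega\subset\mathbb R^d$ be a nonempty bounded open set. Let $\mathcal A=-\Delta$ be the Dirichlet Laplacian in the real Hilbert space $L^2(\Omega)$, with domain $U=\{u\in H_0^1(\Omega):\Delta u\in L^2(\Omega)\}$ (which is $H^2(\Omega)\cap H^1_0(\Omega)$ whenever the Dirichlet problem is $H^2$-regular on $\Omega$). It is a bijection $U\to L^2(\Omega)$, and $U$ is a Hilbert space with the inner product $\langle u,v\rangle_U=\int_\Omega \mathcal A u\,\mathcal A v\,dx$. Consider the all-at-once operator of the Poisson source problem with full observation, $$\mathcal G=\begin{pmatrix}\mathcal A&-I\\ I&0\end{pmatrix}:U\times L^2(\Omega)\to L^2(\Omega)\times L^2(\Omega),$$ and the transformation $\mathcal T=\begin{pmatrix}\mathcal A&0\\0&I\end{pmatrix}:U\times L^2(\Omega)\to L^2(\Omega)\times L^2(\Omega)$, and set $\widetilde{\mathcal G^*\mathcal G}=(\mathcal T^{-1})^*\mathcal G^*\mathcal G\,\mathcal T^{-1}$, with Hilbert space adjoints. Then: 1. On $L^2(\Omega)\times L^2(\Omega)$, $$\widetilde{\mathcal G^*\mathcal G}=\begin{pmatrix}I+\mathcal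 A^{-2}&-I\\-I&I\end{pmatrix}.$$ 2. The eigenvalues of $\widetilde{\mathcal G^*\mathcal G}$ are exactly the numbers $$\lambda_\pm(\mu)=1+\frac\mu2\pm\sqrt{1+\frac{\mu^2}{4}},$$ where $\mu$ runs over the eigenvalues of $\mathcal A^{-2}$. If $\mu$ is an eigenvalue of $\mathcal A^{-2}$ and $\lambda=\lambda_+(\mu)$ or $\lambda=\lambda_-(\mu)$, then $(f,g)$ satisfies $\widetilde{\mathcal G^*\mathcal G}(f,g)=\lambda (f,g)$ if and only if $\mathcal A^{-2}g=\mu g$ and $f=(1-\lambda)g$. 3. For the forward operator $G=\mathcal A^{-1}:L^2(\Omega)\to L^2(\Omega)$, $\theta\mapsto u$, of the reduced problem, $G^*G=\mathcal A^{-2}$. There are an orthonormal basis $(e_n)_{n\in\mathbb N}$ of $L^2(\Omega)$ and a nonincreasing sequence of $\mu_n>0$ with $\mathcal A^{-2}e_n=\mu_ne_n$ and $\mu_n\to0$, such that the two corresponding sequences of eigenvalues of $\widetilde{\mathcal G^*\mathcal G}$ satisfy $$\lambda_-(\mu_n)\to0,\quad \frac{\lambda_-(\mu_n)}{\mu_n}\to\frac12,\qquad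 \lambda_+(\mu_n)\to2,\quad \frac{\lambda_+(\mu_n)-2}{\mu_n}\to\frac12 .$$ Thus one sequence tends to $0$ at the rate of $\mu_n$, as in the reduced problem, and the other one tends to $2$ at the same rate. The accumulation points of the set of eigenvalues of $\widetilde{\mathcal G^*\mathcal G}$ are exactly $0$ and $2$. -/

import Mathlib

open MeasureTheory Filter Topology InnerProductSpace
open scoped Distributions LineDeriv

noncomputable section

namespace PoissonSource

/-- A nonempty bounded open subset of `ℝ^d`, with no regularity of the boundary required. -/
structure BoundedOpenSet (d : ℕ) where
  toOpens : TopologicalSpace.Opens (EuclideanSpace ℝ (Fin d))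
  nonempty : (toOpens : Set (EuclideanSpace ℝ (Fin d))).Nonempty
  bounded : Bornology.IsBounded (toOpens : Set (EuclideanSpace ℝ (Fin d)))

/-- Real test functions: smooth with compact support in `Ω`. -/
abbrev Test {d : ℕ} (Ω : BoundedOpenSet d) := 𝓓(Ω.toOpens, ℝ)

/-- The real Hilbert space `L²(Ω)`. -/
abbrev L2 {d : ℕ} (Ω : BoundedOpenSet d) :=
  Lp ℝ 2 (volume.restrict (Ω.toOpens : Set (EuclideanSpace ℝ (Fin d))))

/-- Vector fields `L²(Ω)^d`. -/
abbrev L2Vec {d : ℕ} (Ω : BoundedOpenSet d) := PiLp 2 (fun _ : Fin d => L2 Ω)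

/-- The Hilbert space `L²(Ω) × L²(Ω)`. -/
abbrev L2Sq {d : ℕ} (Ω : BoundedOpenSet d) := WithLp 2 (L2 Ω × L2 Ω)

variable {d : ℕ} (Ω : BoundedOpenSet d)

theorem memLp_test (φ : Test Ω) :
    MemLp φ 2 (volume.restrict (Ω.toOpens : Set (EuclideanSpace ℝ (Fin d)))) :=
  (φ.continuous.memLp_of_hasCompactSupport φ.hasCompactSupport).restrict _

/-- The class in `L²(Ω)` of a test function. -/
def testL2 : Test Ω →ₗ[ℝ] L2 Ω where
  toFun φ := (memLp_test Ω φ).toLp φ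
  map_add' φ ψ := by rw [← MemLp.toLp_add]; rfl
  map_smul' c φ := by rw [RingHom.id_apply, ← MemLp.toLp_const_smul]; rfl

/-- The gradient in `L²(Ω)^d` of a test function. -/
def testGrad : Test Ω →ₗ[ℝ] L2Vec Ω where
  toFun φ := WithLp.toLp 2 fun i => testL2 Ω (∂_{EuclideanSpace.single i (1 : ℝ)} φ)
  map_add' φ ψ := by
    ext1 i; simp [LineDeriv.lineDerivOp_add]
  map_smul' c φ := by
    ext1 i; simp [LineDeriv.lineDerivOp_smul]

/-- The pair `(φ, ∇φ)` of a test function. -/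
def testGraph : Test Ω →ₗ[ℝ] WithLp 2 (L2 Ω × L2Vec Ω) where
  toFun φ := WithLp.toLp 2 (testL2 Ω φ, testGrad Ω φ)
  map_add' φ ψ := by rw [map_add, map_add]; rfl
  map_smul' c φ := by rw [map_smul, map_smul]; rfl

/-- The pairs `(u, ∇u)` with `u ∈ H¹₀(Ω)`: the closure of the pairs `(φ, ∇φ)`, for `φ` a test
function, in the norm `(‖u‖² + ‖∇u‖²)^{1/2}`. -/
def H10Graph : Submodule ℝ (WithLp 2 (L2 Ω × L2Vec Ω)) :=
  (LinearMap.range (testGraph Ω)).topologicalClosure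

/-- The Sobolev space `H¹₀(Ω)` as a subspace of `L²(Ω)`. -/
def H10 : Set (L2 Ω) := {u | ∃ G : L2Vec Ω, WithLp.toLp 2 (u, G) ∈ H10Graph Ω}

/-- The graph of the Dirichlet Laplacian: pairs `(u, f)` with `u ∈ H¹₀(Ω)` and
`∫ ∇u · ∇φ = ∫ f φ` for all test functions `φ`, that is `-Δu = f ∈ L²(Ω)` in the weak sense. -/
def laplacianGraph : Submodule ℝ (L2 Ω × L2 Ω) where
  carrier := {p | ∃ G : L2Vec Ω, WithLp.toLp 2 (p.1, G) ∈ H10Graph Ω ∧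
    ∀ φ : Test Ω, ⟪G, testGrad Ω φ⟫_ℝ = ⟪p.2, testL2 Ω φ⟫_ℝ}
  zero_mem' := ⟨0, (H10Graph Ω).zero_mem, fun φ => by simp⟩
  add_mem' := by
    rintro p q ⟨G, hG, h⟩ ⟨G', hG', h'⟩
    exact ⟨G + G', (H10Graph Ω).add_mem hG hG', fun φ => by
      simp only [inner_add_left, h, h', Prod.snd_add]⟩
  smul_mem' := by
    rintro c p ⟨G, hG, h⟩
    exact ⟨c • G, (H10Graph Ω).smul_mem c hG, fun φ => by
      simp only [real_inner_smul_left, h, Prod.smul_snd]⟩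

/-- The Dirichlet Laplacian `A = -Δ` as an unbounded operator in `L²(Ω)`, with domain
`D(A) = {u ∈ H¹₀(Ω) : Δu ∈ L²(Ω)}`. -/
def dirichletLaplacian : L2 Ω →ₗ.[ℝ] L2 Ω := (laplacianGraph Ω).toLinearPMap

/-! ### Well-definedness and bijectivity of the Dirichlet Laplacian -/

theorem inner_testL2 (u : L2 Ω) (φ : Test Ω) :
    ⟪u, testL2 Ω φ⟫_ℝ = ∫ x in (Ω.toOpens : Set (EuclideanSpace ℝ (Fin d))), u x * φ x := by
  rw [L2.inner_def]
  refine integral_congr_ae ?_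
  filter_upwards [(memLp_test Ω φ).coeFn_toLp] with x hx
  simp only [testL2, LinearMap.coe_mk, AddHom.coe_mk, hx]
  simp [mul_comm]

theorem eq_zero_of_forall_inner_test {u : L2 Ω} (h : ∀ φ : Test Ω, ⟪u, testL2 Ω φ⟫_ℝ = 0) :
    u = 0 := by
  have hloc : LocallyIntegrableOn u (Ω.toOpens : Set (EuclideanSpace ℝ (Fin d)))
      (volume.restrict (Ω.toOpens : Set (EuclideanSpace ℝ (Fin d)))) :=
    ((Lp.memLp u).locallyIntegrable (by norm_num)).locallyIntegrableOn _
  have key := IsOpen.ae_eq_zero_of_integral_contDiff_smul_eq_zero Ω.toOpens.isOpen hloc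
    (fun g hg hc hs => by
      have := h ⟨g, hg, hc, hs⟩
      rw [inner_testL2] at this
      rw [← this]
      refine integral_congr_ae (Eventually.of_forall fun x => ?_)
      exact mul_comm _ _)
  rw [Lp.eq_zero_iff_ae_eq_zero]
  filter_upwards [key, ae_restrict_mem Ω.toOpens.isOpen.measurableSet] with x hx hm
  exact hx hm

theorem inner_test_test (φ ψ : Test Ω) :
    ⟪testL2 Ω φ, testL2 Ω ψ⟫_ℝ = ∫ x, φ x * ψ x := by
  have h0 : ∀ x, x ∉ (Ω.toOpens : Set (EuclideanSpace ℝ (Fin d))) → φ x * ψ x = 0 := by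
    intro x hx
    have : φ x = 0 := image_eq_zero_of_notMem_tsupport fun h => hx (φ.tsupport_subset h)
    simp [this]
  rw [inner_testL2, ← setIntegral_eq_integral_of_forall_compl_eq_zero h0]
  refine integral_congr_ae ?_
  filter_upwards [(memLp_test Ω φ).coeFn_toLp] with x hx
  simp only [testL2, LinearMap.coe_mk, AddHom.coe_mk, hx]

theorem lineDeriv_test_apply (φ : Test Ω) (v x : EuclideanSpace ℝ (Fin d)) :
    (∂_{v} φ) x = fderiv ℝ φ x v := by
  rw [TestFunction.lineDerivOp_eq_lineDerivCLM ℝ, TestFunction.lineDerivCLM_apply_of_le (by simp)]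
  exact (φ.contDiff.differentiable (by simp)).differentiableAt.lineDeriv_eq_fderiv

theorem integrable_mul_test {u : EuclideanSpace ℝ (Fin d) → ℝ} (hu : Continuous u) (φ : Test Ω) :
    Integrable (fun x => u x * φ x) :=
  (hu.mul φ.continuous).integrable_of_hasCompactSupport φ.hasCompactSupport.mul_left

theorem inner_test_lineDeriv (φ ψ : Test Ω) (v : EuclideanSpace ℝ (Fin d)) :
    ⟪testL2 Ω φ, testL2 Ω (∂_{v} ψ)⟫_ℝ = -⟪testL2 Ω (∂_{v} φ), testL2 Ω ψ⟫_ℝ := by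
  rw [inner_test_test, inner_test_test]
  have h1 := integrable_mul_test Ω (∂_{v} φ).continuous ψ
  have h2 := integrable_mul_test Ω φ.continuous (∂_{v} ψ)
  have h3 := integrable_mul_test Ω φ.continuous ψ
  simp only [lineDeriv_test_apply] at h1 h2 ⊢
  exact integral_mul_fderiv_eq_neg_fderiv_mul_of_integrable h1 h2 h3
    (fun x _ => (φ.contDiff.differentiable (by simp)).differentiableAt)
    (fun x _ => (ψ.contDiff.differentiable (by simp)).differentiableAt)

/-- A property of pairs `(u, G)` that is closed and holds for `(φ, ∇φ)` holds on `H10Graph`. -/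
theorem H10Graph_induction {P : L2 Ω → L2Vec Ω → Prop}
    (hc : IsClosed {w : WithLp 2 (L2 Ω × L2Vec Ω) | P w.fst w.snd})
    (ht : ∀ φ : Test Ω, P (testL2 Ω φ) (testGrad Ω φ))
    {w : WithLp 2 (L2 Ω × L2Vec Ω)} (hw : w ∈ H10Graph Ω) : P w.fst w.snd := by
  have : (H10Graph Ω : Set (WithLp 2 (L2 Ω × L2Vec Ω))) ⊆ {w | P w.fst w.snd} := by
    rw [H10Graph, Submodule.topologicalClosure_coe]
    refine closure_minimal ?_ hc
    rintro _ ⟨φ, rfl⟩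
    exact ht φ
  exact this hw

/-- The second component of an element of `H10Graph` is the weak gradient of the first. -/
theorem weak_gradient {w : WithLp 2 (L2 Ω × L2Vec Ω)} (hw : w ∈ H10Graph Ω) (i : Fin d)
    (ψ : Test Ω) :
    ⟪w.fst, testL2 Ω (∂_{EuclideanSpace.single i (1 : ℝ)} ψ)⟫_ℝ =
      -⟪w.snd i, testL2 Ω ψ⟫_ℝ :=
  H10Graph_induction Ω
    (P := fun u G => ⟪u, testL2 Ω (∂_{EuclideanSpace.single i (1 : ℝ)} ψ)⟫_ℝ =
      -⟪G i, testL2 Ω ψ⟫_ℝ)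
    (isClosed_eq (by fun_prop) (by fun_prop))
    (fun φ => inner_test_lineDeriv Ω φ ψ _) hw

theorem gradient_unique {G : L2Vec Ω} (h : WithLp.toLp 2 ((0 : L2 Ω), G) ∈ H10Graph Ω) :
    G = 0 := by
  ext1 i
  refine eq_zero_of_forall_inner_test Ω fun φ => ?_
  have := weak_gradient Ω h i φ
  simpa using this

theorem mem_laplacianGraph {u f : L2 Ω} : (u, f) ∈ laplacianGraph Ω ↔
    ∃ G : L2Vec Ω, WithLp.toLp 2 (u, G) ∈ H10Graph Ω ∧
      ∀ φ : Test Ω, ⟪G, testGrad Ω φ⟫_ℝ = ⟪f, testL2 Ω φ⟫_ℝ := Iff.rfl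

theorem laplacianGraph_single_valued (p : L2 Ω × L2 Ω) (hp : p ∈ laplacianGraph Ω)
    (h0 : p.1 = 0) : p.2 = 0 := by
  obtain ⟨G, hG, h⟩ := hp
  rw [h0] at hG
  have hG0 := gradient_unique Ω hG
  refine eq_zero_of_forall_inner_test Ω fun φ => ?_
  rw [← h φ, hG0, inner_zero_left]

/-- The Poincaré inequality for test functions. -/
theorem exists_poincare_test [NeZero d] :
    ∃ C : ℝ, 0 ≤ C ∧ ∀ φ : Test Ω, ‖testL2 Ω φ‖ ≤ C * ‖testGrad Ω φ‖ := by
  obtain ⟨R, hR0, hR⟩ := Ω.bounded.exists_pos_norm_le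
  refine ⟨2 * R, by positivity, fun φ => ?_⟩
  set v : EuclideanSpace ℝ (Fin d) := EuclideanSpace.single 0 (1 : ℝ) with hv
  have hle : ‖testL2 Ω (∂_{v} φ)‖ ≤ ‖testGrad Ω φ‖ :=
    PiLp.norm_apply_le (testGrad Ω φ) 0
  refine le_trans ?_ (mul_le_mul_of_nonneg_left hle (by positivity))
  refine abs_le_of_sq_le_sq' ?_ (by positivity) |>.2
  rw [mul_pow, ← real_inner_self_eq_norm_sq, ← real_inner_self_eq_norm_sq, inner_test_test,
    inner_test_test]
  have hφd : Differentiable ℝ φ := φ.contDiff.differentiable (by simp)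
  have hcx : Continuous fun x : EuclideanSpace ℝ (Fin d) => x 0 := by fun_prop
  have hdx : ∀ x : EuclideanSpace ℝ (Fin d),
      HasFDerivAt (fun x : EuclideanSpace ℝ (Fin d) => x 0)
        (EuclideanSpace.proj (0 : Fin d) : EuclideanSpace ℝ (Fin d) →L[ℝ] ℝ) x :=
    fun x => (EuclideanSpace.proj (0 : Fin d) : EuclideanSpace ℝ (Fin d) →L[ℝ] ℝ).hasFDerivAt
  have hdxφ : ∀ x : EuclideanSpace ℝ (Fin d),
      fderiv ℝ (fun x : EuclideanSpace ℝ (Fin d) => x 0 * φ x) x v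
        = x 0 * (∂_{v} φ) x + φ x := by
    intro x
    have := ((hdx x).mul (hφd x).hasFDerivAt).fderiv
    change fderiv ℝ (fun x : EuclideanSpace ℝ (Fin d) => x 0 * φ x) x = _ at this
    rw [this, lineDeriv_test_apply]
    simp [hv]
  have i1 : Integrable fun x : EuclideanSpace ℝ (Fin d) => φ x * φ x :=
    integrable_mul_test Ω φ.continuous φ
  have i2 : Integrable fun x : EuclideanSpace ℝ (Fin d) => (x 0 * φ x) * (∂_{v} φ) x :=
    integrable_mul_test Ω (hcx.mul φ.continuous) (∂_{v} φ)
  have i3 : Integrable fun x : EuclideanSpace ℝ (Fin d) => (∂_{v} φ) x * (∂_{v} φ) x :=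
    integrable_mul_test Ω (∂_{v} φ).continuous (∂_{v} φ)
  have i4 : Integrable fun x : EuclideanSpace ℝ (Fin d) => (x 0 * φ x) * φ x :=
    integrable_mul_test Ω (hcx.mul φ.continuous) φ
  have ibp := integral_mul_fderiv_eq_neg_fderiv_mul_of_integrable (μ := volume)
    (f := fun x : EuclideanSpace ℝ (Fin d) => x 0 * φ x) (g := φ) (v := v)
    (by
      simp only [hdxφ]
      refine (i2.add i1).congr (Eventually.of_forall fun x => ?_)
      simp only [Pi.add_apply]; ring)
    (by simpa only [lineDeriv_test_apply] using i2) i4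
    (fun x _ => ((hdx x).mul (hφd x).hasFDerivAt).differentiableAt) (fun x _ => hφd x)
  simp only [hdxφ, ← lineDeriv_test_apply] at ibp
  have e1 : ∫ x : EuclideanSpace ℝ (Fin d), (x 0 * (∂_{v} φ) x + φ x) * φ x
      = (∫ x : EuclideanSpace ℝ (Fin d), (x 0 * φ x) * (∂_{v} φ) x) + ∫ x, φ x * φ x := by
    rw [← integral_add i2 i1]
    exact integral_congr_ae (Eventually.of_forall fun x => by ring)
  rw [e1] at ibp
  have hpt : ∀ x : EuclideanSpace ℝ (Fin d),
      -(2 * ((x 0 * φ x) * (∂_{v} φ) x)) ≤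
        1 / 2 * (φ x * φ x) + 2 * R ^ 2 * ((∂_{v} φ) x * (∂_{v} φ) x) := by
    intro x
    by_cases hx : x ∈ (Ω.toOpens : Set (EuclideanSpace ℝ (Fin d)))
    · have h0 : |x 0| ≤ R := (PiLp.norm_apply_le x 0).trans (hR x hx)
      have h1 : x 0 ^ 2 ≤ R ^ 2 := sq_le_sq' (abs_le.1 h0).1 (abs_le.1 h0).2
      nlinarith [sq_nonneg (φ x + 2 * x 0 * (∂_{v} φ) x),
        mul_le_mul_of_nonneg_right h1 (mul_self_nonneg ((∂_{v} φ) x))]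
    · have : φ x = 0 := image_eq_zero_of_notMem_tsupport fun h => hx (φ.tsupport_subset h)
      rw [this]
      have := mul_self_nonneg ((∂_{v} φ) x)
      have := mul_nonneg (sq_nonneg R) this
      nlinarith
  have hint := integral_mono (i2.const_mul 2).neg ((i1.const_mul (1 / 2)).add
    (i3.const_mul (2 * R ^ 2))) hpt
  simp only [Pi.neg_apply, Pi.add_apply] at hint
  rw [integral_neg, integral_add (i1.const_mul (1 / 2)) (i3.const_mul (2 * R ^ 2)),
    integral_const_mul, integral_const_mul, integral_const_mul] at hint
  nlinarith

/-- The Poincaré inequality on `H¹₀(Ω)`. -/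
theorem exists_poincare [NeZero d] :
    ∃ C : ℝ, 0 ≤ C ∧ ∀ w ∈ H10Graph Ω, ‖w.fst‖ ≤ C * ‖w.snd‖ := by
  obtain ⟨C, hC, h⟩ := exists_poincare_test Ω
  refine ⟨C, hC, fun w hw => ?_⟩
  exact H10Graph_induction Ω (P := fun u G => ‖u‖ ≤ C * ‖G‖)
    (isClosed_le (by fun_prop) (by fun_prop)) h hw

theorem laplacianGraph_weak {f : L2 Ω} {G : L2Vec Ω}
    (h : ∀ φ : Test Ω, ⟪G, testGrad Ω φ⟫_ℝ = ⟪f, testL2 Ω φ⟫_ℝ)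
    {w : WithLp 2 (L2 Ω × L2Vec Ω)} (hw : w ∈ H10Graph Ω) : ⟪G, w.snd⟫_ℝ = ⟪f, w.fst⟫_ℝ :=
  H10Graph_induction Ω (P := fun v V => ⟪G, V⟫_ℝ = ⟪f, v⟫_ℝ)
    (isClosed_eq (by fun_prop) (by fun_prop)) h hw

theorem exists_laplacian_bound [NeZero d] :
    ∃ C : ℝ, 0 ≤ C ∧ ∀ u f : L2 Ω, (u, f) ∈ laplacianGraph Ω → ‖u‖ ≤ C * ‖f‖ := by
  obtain ⟨C, hC, h⟩ := exists_poincare Ω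
  refine ⟨C ^ 2, sq_nonneg C, fun u f hp => ?_⟩
  obtain ⟨G, hG, hw⟩ := (mem_laplacianGraph Ω).1 hp
  have h1 : ‖u‖ ≤ C * ‖G‖ := h (WithLp.toLp 2 (u, G)) hG
  have h2 : ⟪G, G⟫_ℝ = ⟪f, u⟫_ℝ :=
    laplacianGraph_weak Ω hw (w := WithLp.toLp 2 (u, G)) hG
  have h3 := real_inner_le_norm f u
  rw [← h2, real_inner_self_eq_norm_sq] at h3
  rcases (norm_nonneg u).eq_or_lt with h0 | h0
  · rw [← h0]; exact mul_nonneg (sq_nonneg C) (norm_nonneg f)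
  · have h4 : ‖u‖ * ‖u‖ ≤ (C ^ 2 * ‖f‖) * ‖u‖ := by
      have h5 := mul_self_le_mul_self h0.le h1
      have h6 := mul_le_mul_of_nonneg_left h3 (sq_nonneg C)
      calc ‖u‖ * ‖u‖ ≤ C * ‖G‖ * (C * ‖G‖) := h5
        _ = C ^ 2 * ‖G‖ ^ 2 := by ring
        _ ≤ C ^ 2 * (‖f‖ * ‖u‖) := h6
        _ = _ := by ring
    exact le_of_mul_le_mul_right h4 h0

theorem lax_milgram {V X Y : Type*} [NormedAddCommGroup V] [InnerProductSpace ℝ V]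
    [CompleteSpace V] [NormedAddCommGroup X] [InnerProductSpace ℝ X] [NormedAddCommGroup Y]
    [InnerProductSpace ℝ Y] (P : V →L[ℝ] X) (Q : V →L[ℝ] Y) {c : ℝ} (hc : 0 < c)
    (h : ∀ v, c * ‖v‖ * ‖v‖ ≤ ⟪Q v, Q v⟫_ℝ) (f : X) :
    ∃ w, ∀ v, ⟪Q w, Q v⟫_ℝ = ⟪f, P v⟫_ℝ := by
  let B : V →L[ℝ] V →L[ℝ] ℝ := (innerSL ℝ).bilinearComp Q Q
  have hB : IsCoercive B := ⟨c, hc, h⟩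
  refine ⟨hB.continuousLinearEquivOfBilin.symm ((toDual ℝ V).symm ((innerSL ℝ f).comp P)),
    fun v => ?_⟩
  change B _ _ = ((innerSL ℝ f).comp P) v
  rw [← hB.continuousLinearEquivOfBilin_apply, ContinuousLinearEquiv.apply_symm_apply,
    toDual_symm_apply]

theorem weak_solution_aux {X Y : Type*} [NormedAddCommGroup X] [InnerProductSpace ℝ X]
    [CompleteSpace X] [NormedAddCommGroup Y] [InnerProductSpace ℝ Y] [CompleteSpace Y]
    (K : Submodule ℝ (WithLp 2 (X × Y))) (hK : IsClosed (K : Set (WithLp 2 (X × Y)))) {C : ℝ}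
    (h : ∀ w ∈ K, ‖w.fst‖ ≤ C * ‖w.snd‖) (f : X) :
    ∃ w ∈ K, ∀ v ∈ K, ⟪w.snd, v.snd⟫_ℝ = ⟪f, v.fst⟫_ℝ := by
  have : CompleteSpace K := hK.completeSpace_coe
  have hC1 : 0 < C ^ 2 + 1 := by positivity
  obtain ⟨w, hw⟩ := lax_milgram ((WithLp.fstL 2 ℝ X Y).comp K.subtypeL)
    ((WithLp.sndL 2 ℝ X Y).comp K.subtypeL) (inv_pos.2 hC1) (fun w => by
      change _ ≤ ⟪(w : WithLp 2 (X × Y)).snd, (w : WithLp 2 (X × Y)).snd⟫_ℝ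
      rw [real_inner_self_eq_norm_sq, mul_assoc, inv_mul_le_iff₀ hC1, ← pow_two]
      have h1 := h (w : WithLp 2 (X × Y)) w.2
      have h2 : ‖w‖ ^ 2 = ‖(w : WithLp 2 (X × Y)).fst‖ ^ 2 + ‖(w : WithLp 2 (X × Y)).snd‖ ^ 2 :=
        WithLp.prod_norm_sq_eq_of_L2 (w : WithLp 2 (X × Y))
      have h3 := mul_self_le_mul_self (norm_nonneg _) h1
      rw [h2]; linarith) f
  exact ⟨w, w.2, fun v hv => hw ⟨v, hv⟩⟩

theorem exists_weak_solution [NeZero d] (f : L2 Ω) : ∃ w ∈ H10Graph Ω,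
    ∀ v ∈ H10Graph Ω, ⟪w.snd, v.snd⟫_ℝ = ⟪f, v.fst⟫_ℝ := by
  obtain ⟨C, _, h⟩ := exists_poincare Ω
  exact weak_solution_aux (H10Graph Ω) (Submodule.isClosed_topologicalClosure _) h f

theorem exists_laplacian_solution [NeZero d] (f : L2 Ω) : ∃ u, (u, f) ∈ laplacianGraph Ω := by
  obtain ⟨w, hw, h⟩ := exists_weak_solution Ω f
  refine ⟨w.fst, (mem_laplacianGraph Ω).2 ⟨w.snd, hw, fun φ => ?_⟩⟩
  exact h (testGraph Ω φ) (Submodule.le_topologicalClosure _ (LinearMap.mem_range_self _ φ))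

theorem mem_laplacianGraph_iff {u f : L2 Ω} : (u, f) ∈ laplacianGraph Ω ↔
    ∃ h : u ∈ (dirichletLaplacian Ω).domain, dirichletLaplacian Ω ⟨u, h⟩ = f := by
  rw [← Submodule.toLinearPMap_graph_eq _ (laplacianGraph_single_valued Ω),
    LinearPMap.mem_graph_iff]
  constructor
  · rintro ⟨y, rfl, hy⟩
    exact ⟨y.2, hy⟩
  · rintro ⟨h, hf⟩
    exact ⟨⟨u, h⟩, rfl, hf⟩

theorem laplacian_mem_graph (u : (dirichletLaplacian Ω).domain) :
    ((u : L2 Ω), dirichletLaplacian Ω u) ∈ laplacianGraph Ω :=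
  (mem_laplacianGraph_iff Ω).2 ⟨u.2, rfl⟩

theorem laplacian_injective [NeZero d] :
    Function.Injective (dirichletLaplacian Ω).toFun := by
  obtain ⟨C, _, h⟩ := exists_laplacian_bound Ω
  refine (injective_iff_map_eq_zero _).2 fun u hu => ?_
  have h1 := h u _ (laplacian_mem_graph Ω u)
  have h2 : dirichletLaplacian Ω u = 0 := hu
  rw [h2, norm_zero, mul_zero, norm_le_zero_iff] at h1
  exact Subtype.ext h1

theorem laplacian_surjective [NeZero d] :
    Function.Surjective (dirichletLaplacian Ω).toFun := by
  intro f
  obtain ⟨u, hu⟩ := exists_laplacian_solution Ω f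
  obtain ⟨h, hf⟩ := (mem_laplacianGraph_iff Ω).1 hu
  exact ⟨⟨u, h⟩, hf⟩

/-! ### Relation to `H²(Ω)` -/

/-- `g` is the weak partial derivative `∂ᵢ u` in `Ω`. -/
def HasWeakPartial (i : Fin d) (u g : L2 Ω) : Prop :=
  ∀ φ : Test Ω, ⟪u, testL2 Ω (∂_{EuclideanSpace.single i (1 : ℝ)} φ)⟫_ℝ = -⟪g, testL2 Ω φ⟫_ℝ

/-- The Sobolev space `H²(Ω)` as a subspace of `L²(Ω)`. -/
def H2 : Set (L2 Ω) :=
  {u | ∃ (G : Fin d → L2 Ω) (K : Fin d → Fin d → L2 Ω),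
    (∀ i, HasWeakPartial Ω i u (G i)) ∧ ∀ i j, HasWeakPartial Ω j (G i) (K i j)}

/-- `A` extends `-Δ` on `H²(Ω) ∩ H¹₀(Ω)`. -/
theorem laplacian_of_H2 {u : L2 Ω} (hu : u ∈ H10 Ω) {G : Fin d → L2 Ω}
    {K : Fin d → L2 Ω} (hG : ∀ i, HasWeakPartial Ω i u (G i))
    (hK : ∀ i, HasWeakPartial Ω i (G i) (K i)) :
    ∃ h : u ∈ (dirichletLaplacian Ω).domain, dirichletLaplacian Ω ⟨u, h⟩ = -∑ i, K i := by
  obtain ⟨G', hG'⟩ := hu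
  have hGG : ∀ i, G' i = G i := fun i => by
    rw [← sub_eq_zero]
    refine eq_zero_of_forall_inner_test Ω fun φ => ?_
    have h1 := weak_gradient Ω hG' i φ
    have h2 := hG i φ
    simp only [WithLp.toLp_fst, WithLp.toLp_snd] at h1
    rw [inner_sub_left]
    linarith
  refine (mem_laplacianGraph_iff Ω).1 ((mem_laplacianGraph Ω).2 ⟨G', hG', fun φ => ?_⟩)
  rw [PiLp.inner_apply, inner_neg_left, sum_inner, ← Finset.sum_neg_distrib]
  refine Finset.sum_congr rfl fun i _ => ?_
  rw [hGG i]
  exact hK i φ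

/-- `D(A) = H²(Ω) ∩ H¹₀(Ω)` as soon as the Dirichlet problem has solutions in `H²(Ω)`. -/
theorem domain_eq_of_H2_regular [NeZero d]
    (hreg : ∀ f, ∃ u ∈ H10 Ω ∩ H2 Ω, (u, f) ∈ laplacianGraph Ω) :
    ((dirichletLaplacian Ω).domain : Set (L2 Ω)) = H10 Ω ∩ H2 Ω := by
  ext u
  constructor
  · intro hu
    obtain ⟨v, hv, hvf⟩ := hreg (dirichletLaplacian Ω ⟨u, hu⟩)
    obtain ⟨h, hf⟩ := (mem_laplacianGraph_iff Ω).1 hvf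
    have := laplacian_injective Ω hf
    rw [Subtype.mk.injEq] at this
    exact this ▸ hv
  · rintro ⟨h1, G, K, hG, hK⟩
    exact (laplacian_of_H2 Ω h1 hG (fun i => hK i i)).1

/-! ### The all-at-once operator -/

/-- The state space `U = D(A)`, with the inner product `⟨u, v⟩_U = ∫ Au Av`. -/
def State : Type := (dirichletLaplacian Ω).domain

instance : AddCommGroup (State Ω) :=
  inferInstanceAs (AddCommGroup (dirichletLaplacian Ω).domain)

instance : Module ℝ (State Ω) := inferInstanceAs (Module ℝ (dirichletLaplacian Ω).domain)

/-- `A` as a map `U → L²(Ω)`. -/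
def stateLaplacian : State Ω →ₗ[ℝ] L2 Ω := (dirichletLaplacian Ω).toFun

instance [NeZero d] : NormedAddCommGroup (State Ω) :=
  NormedAddCommGroup.induced (State Ω) (L2 Ω) (stateLaplacian Ω) (laplacian_injective Ω)

instance [NeZero d] : InnerProductSpace ℝ (State Ω) where
  __ := NormedSpace.induced ℝ (State Ω) (L2 Ω) (stateLaplacian Ω)
  inner u v := ⟪stateLaplacian Ω u, stateLaplacian Ω v⟫_ℝ
  norm_sq_eq_re_inner u := (real_inner_self_eq_norm_sq (stateLaplacian Ω u)).symm
  conj_inner_symm u v := real_inner_comm (stateLaplacian Ω u) (stateLaplacian Ω v)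
  add_left u v w := by rw [map_add, inner_add_left]
  smul_left u v r := by rw [map_smul, real_inner_smul_left]; rfl

/-- `A : U → L²(Ω)`, which is a unitary operator. -/
def laplacianIso [NeZero d] : State Ω ≃ₗᵢ[ℝ] L2 Ω where
  __ := LinearEquiv.ofBijective (stateLaplacian Ω)
    ⟨laplacian_injective Ω, laplacian_surjective Ω⟩
  norm_map' _ := rfl

instance [NeZero d] : CompleteSpace (State Ω) :=
  (laplacianIso Ω).toIsometryEquiv.completeSpace

/-- The embedding `U → L²(Ω)`. -/
def embed [NeZero d] : State Ω →L[ℝ] L2 Ω :=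
  LinearMap.mkContinuousOfExistsBound (dirichletLaplacian Ω).domain.subtype (by
    obtain ⟨C, _, h⟩ := exists_laplacian_bound Ω
    exact ⟨C, fun u => h u.1 _ (laplacian_mem_graph Ω u)⟩)

/-- The inverse `A⁻¹ : L²(Ω) → L²(Ω)` of the Dirichlet Laplacian. -/
def laplacianInv [NeZero d] : L2 Ω →L[ℝ] L2 Ω :=
  embed Ω ∘L ((laplacianIso Ω).symm : L2 Ω →L[ℝ] State Ω)

/-- The all-at-once operator `𝒢 (u, θ) = (A u - θ, u)` from `U × L²(Ω)` to `L²(Ω) × L²(Ω)`. -/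
def aaoOperator [NeZero d] : WithLp 2 (State Ω × L2 Ω) →L[ℝ] L2Sq Ω :=
  ((WithLp.prodContinuousLinearEquiv 2 ℝ (L2 Ω) (L2 Ω)).symm :
      L2 Ω × L2 Ω →L[ℝ] WithLp 2 (L2 Ω × L2 Ω)) ∘L
    ((((laplacianIso Ω : State Ω →L[ℝ] L2 Ω) ∘L WithLp.fstL 2 ℝ (State Ω) (L2 Ω)) -
        WithLp.sndL 2 ℝ (State Ω) (L2 Ω)).prod
      (embed Ω ∘L WithLp.fstL 2 ℝ (State Ω) (L2 Ω)))

/-- The transformation `𝒯 (u, θ) = (A u, θ)` from `U × L²(Ω)` to `L²(Ω) × L²(Ω)`. -/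
def aaoTransform [NeZero d] : WithLp 2 (State Ω × L2 Ω) ≃ₗᵢ[ℝ] L2Sq Ω :=
  LinearIsometryEquiv.withLpProdCongr 2 (laplacianIso Ω) (LinearIsometryEquiv.refl ℝ (L2 Ω))

/-- The transformed operator `(𝒯⁻¹)* 𝒢* 𝒢 𝒯⁻¹`, with Hilbert space adjoints. -/
def transformedOperator [NeZero d] : L2Sq Ω →L[ℝ] L2Sq Ω :=
  ContinuousLinearMap.adjoint
      ((aaoTransform Ω).symm : L2Sq Ω →L[ℝ] WithLp 2 (State Ω × L2 Ω)) ∘L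
    ContinuousLinearMap.adjoint (aaoOperator Ω) ∘L aaoOperator Ω ∘L
      ((aaoTransform Ω).symm : L2Sq Ω →L[ℝ] WithLp 2 (State Ω × L2 Ω))

/-- The reduced forward operator `θ ↦ u`, where `u ∈ U` is the state with `A u = θ`, observed on
all of `Ω`. -/
def reducedOperator [NeZero d] : L2 Ω →L[ℝ] L2 Ω :=
  embed Ω ∘L ((laplacianIso Ω).symm : L2 Ω →L[ℝ] State Ω)

/-- `λ` is an eigenvalue of the bounded operator `B`. -/
abbrev IsEigenvalue {V : Type*} [NormedAddCommGroup V] [NormedSpace ℝ V] (B : V →L[ℝ] V)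
    (l : ℝ) : Prop :=
  Module.End.HasEigenvalue (B : Module.End ℝ V) l

/-- The larger root `1 + μ/2 + √(1 + μ²/4)`. -/
def upperRoot (μ : ℝ) : ℝ := 1 + μ / 2 + √(1 + μ ^ 2 / 4)

/-- The smaller root `1 + μ/2 - √(1 + μ²/4)`. -/
def lowerRoot (μ : ℝ) : ℝ := 1 + μ / 2 - √(1 + μ ^ 2 / 4)

end PoissonSource

end

open PoissonSource

/-!
Since `𝒢 𝒯⁻¹ (f, g) = (f - g, A⁻¹ f)` and `A⁻¹` is self-adjoint, the block form follows by
comparing inner products. In the eigenvalue equation the second component gives `f = (1 - λ) g`,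
and the first one then becomes `(1 - λ) A⁻² g = (1 - (1 - λ)²) g`. Here `λ = 1` forces `g = 0`, so
`g` is an eigenvector of `A⁻²` for an eigenvalue `μ` with `λ² - (2 + μ) λ + μ = 0`, whose roots are
`λ±(μ)`. The asymptotics come from `λ₊ + λ₋ = 2 + μ` and `λ₊ λ₋ = μ`.

The analytic part is that `A⁻²` has an orthonormal eigenbasis with eigenvalues decreasing to `0`.
It is self-adjoint, and positive because `A⁻¹` is injective, so
`exists_hilbertBasis_nat_antitone` applies once `A⁻¹` is known to be compact: Hilbert bases of the
eigenspaces together form a Hilbert basis, only finitely many of its eigenvalues exceed a given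
threshold, and hence they can be listed in nonincreasing order.

Compactness of `A⁻¹` (`isCompactOperator_laplacianInv`) is Rellich's theorem, proved without any
regularity of the boundary. Replacing a test function `φ` by its mean values on the cubes of a grid
of side `h` changes it in `L²` by at most a constant times `h ‖∇φ‖`
(`lintegral_sub_gridAverage_sq_le`), because `φ` differs from its translate by `z` by at most
`‖z‖ ‖∇φ‖`. As `Ω` is bounded, these step functions span a finite-dimensional space, so `A⁻¹` is a
norm limit of operators of finite rank.

The eigenvalues of the transformed operator are thus the terms of two sequences which converge to
`0` and to `2` without attaining these limits, which gives the accumulation points.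
-/

namespace PoissonSource

/-! ### Approximation by step functions on a grid -/

/-- The Cauchy–Schwarz inequality against the constant function `1`. -/
theorem sq_lintegral_le_measure_univ_mul {α : Type*} [MeasurableSpace α] (μ : Measure α)
    {f : α → ENNReal} (hf : AEMeasurable f μ) :
    (∫⁻ x, f x ∂μ) ^ 2 ≤ μ Set.univ * ∫⁻ x, f x ^ 2 ∂μ := by
  have h := ENNReal.lintegral_mul_le_Lp_mul_Lq μ Real.HolderConjugate.two_two
    (f := fun _ => 1) aemeasurable_const hf
  simp only [Pi.mul_apply, one_mul, lintegral_const, ENNReal.rpow_two] at h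
  refine (pow_le_pow_left' h 2).trans_eq ?_
  rw [mul_pow, one_pow, one_mul, ← ENNReal.rpow_natCast, ← ENNReal.rpow_natCast,
    ← ENNReal.rpow_mul, ← ENNReal.rpow_mul]
  norm_num

section Translation

variable {E : Type*} [NormedAddCommGroup E] [NormedSpace ℝ E]

theorem enorm_translate_sub_sq_le {φ : E → ℝ} (hφ : ContDiff ℝ 1 φ) (x z : E) :
    ‖φ (x + z) - φ x‖ₑ ^ 2 ≤ ∫⁻ t in Set.Ioc (0 : ℝ) 1, ‖fderiv ℝ φ (x + t • z) z‖ₑ ^ 2 := by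
  have hline : ∀ t : ℝ, HasDerivAt (fun t : ℝ => φ (x + t • z)) (fderiv ℝ φ (x + t • z) z) t := by
    intro t
    have h1 : HasDerivAt (fun t : ℝ => x + t • z) z t := by
      simpa using ((hasDerivAt_id t).smul_const z).const_add x
    exact ((hφ.differentiable one_ne_zero) _).hasFDerivAt.comp_hasDerivAt t h1
  have hc : Continuous fun t : ℝ => fderiv ℝ φ (x + t • z) z :=
    ((hφ.continuous_fderiv one_ne_zero).comp (by fun_prop)).clm_apply continuous_const
  have hftc := intervalIntegral.integral_eq_sub_of_hasDerivAt (a := 0) (b := 1)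
    (fun t _ => hline t) (hc.intervalIntegrable _ _)
  rw [intervalIntegral.integral_of_le zero_le_one] at hftc
  simp only [one_smul, zero_smul, add_zero] at hftc
  rw [← hftc]
  refine (pow_le_pow_left' (enorm_integral_le_lintegral_enorm _) 2).trans ?_
  refine (sq_lintegral_le_measure_univ_mul _ hc.enorm.aemeasurable).trans_eq ?_
  simp

theorem lintegral_translate_sub_sq_le [MeasurableSpace E] [BorelSpace E]
    [SecondCountableTopology E] {μ : Measure E} [SFinite μ] [μ.IsAddRightInvariant]
    {φ : E → ℝ} (hφ : ContDiff ℝ 1 φ) (z : E) :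
    ∫⁻ x, ‖φ (x + z) - φ x‖ₑ ^ 2 ∂μ ≤ ∫⁻ x, ‖fderiv ℝ φ x z‖ₑ ^ 2 ∂μ := by
  refine (lintegral_mono fun x => enorm_translate_sub_sq_le hφ x z).trans_eq ?_
  have hc : Continuous fun p : E × ℝ => fderiv ℝ φ (p.1 + p.2 • z) z :=
    ((hφ.continuous_fderiv one_ne_zero).comp (by fun_prop)).clm_apply continuous_const
  rw [lintegral_lintegral_swap ((hc.enorm.measurable.pow_const 2).aemeasurable)]
  have h : ∀ t : ℝ, ∫⁻ x, ‖fderiv ℝ φ (x + t • z) z‖ₑ ^ 2 ∂μ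
      = ∫⁻ x, ‖fderiv ℝ φ x z‖ₑ ^ 2 ∂μ := fun t =>
    lintegral_add_right_eq_self (fun x => ‖fderiv ℝ φ x z‖ₑ ^ 2) (t • z)
  simp [h]

end Translation

/-- The index of the cube of side `h` of the grid `h ℤ^d` that contains `x`. -/
noncomputable def gridIndex {d : ℕ} (h : ℝ) (x : EuclideanSpace ℝ (Fin d)) : Fin d → ℤ :=
  fun i => ⌊x i / h⌋

/-- The half-open cube of side `h` with index `k`. -/
def gridCell {d : ℕ} (h : ℝ) (k : Fin d → ℤ) : Set (EuclideanSpace ℝ (Fin d)) :=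
  gridIndex h ⁻¹' {k}

section Grid

variable {d : ℕ} {h : ℝ}

theorem measurable_gridIndex : Measurable (gridIndex (d := d) h) := by
  refine measurable_pi_lambda _ fun i => Int.measurable_floor.comp ?_
  have : Continuous fun x : EuclideanSpace ℝ (Fin d) => x i / h := by fun_prop
  exact this.measurable

theorem measurableSet_gridCell (k : Fin d → ℤ) : MeasurableSet (gridCell h k) :=
  measurable_gridIndex (measurableSet_singleton k)

theorem norm_sub_le_of_mem_gridCell (hh : 0 < h) {k : Fin d → ℤ}
    {x y : EuclideanSpace ℝ (Fin d)} (hx : x ∈ gridCell h k) (hy : y ∈ gridCell h k) :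
    ‖y - x‖ ≤ d * h := by
  have hcoord : ∀ i, ‖(y - x) i‖ ≤ h := by
    intro i
    have h1 : ⌊x i / h⌋ = k i := congrFun hx i
    have h2 : ⌊y i / h⌋ = k i := congrFun hy i
    rw [Int.floor_eq_iff, le_div_iff₀ hh, div_lt_iff₀ hh] at h1 h2
    rw [PiLp.sub_apply, Real.norm_eq_abs, abs_le]
    constructor <;> linarith [h1.1, h1.2, h2.1, h2.2]
  calc ‖y - x‖ ≤ ∑ i, ‖(y - x) i‖ := by
        rw [EuclideanSpace.norm_eq]
        refine Real.sqrt_le_iff.2 ⟨Finset.sum_nonneg fun i _ => norm_nonneg _, ?_⟩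
        exact Finset.sum_sq_le_sq_sum_of_nonneg fun i _ => norm_nonneg _
    _ ≤ ∑ _i : Fin d, h := Finset.sum_le_sum fun i _ => hcoord i
    _ = d * h := by simp

theorem volume_ball_le_volume_gridCell (hh : 0 < h) (k : Fin d → ℤ) :
    volume (Metric.ball (0 : EuclideanSpace ℝ (Fin d)) (h / 2)) ≤ volume (gridCell h k) := by
  set c : EuclideanSpace ℝ (Fin d) := WithLp.toLp 2 fun i => (k i + 1 / 2) * h with hc
  rw [← Measure.addHaar_ball_center volume c]
  refine measure_mono fun y hy => funext fun i => ?_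
  have h1 : |y i - (k i + 1 / 2) * h| < h / 2 := by
    have := (PiLp.norm_apply_le (y - c) i).trans_lt (mem_ball_iff_norm.1 hy)
    simpa [hc] using this
  rw [abs_lt] at h1
  change ⌊y i / h⌋ = k i
  rw [Int.floor_eq_iff, le_div_iff₀ hh, div_lt_iff₀ hh]
  constructor <;> linarith [h1.1, h1.2]

theorem volume_gridCell_lt_top (hh : 0 < h) (k : Fin d → ℤ) :
    volume (gridCell (d := d) h k) < ⊤ := by
  rcases (gridCell (d := d) h k).eq_empty_or_nonempty with h0 | ⟨x, hx⟩
  · simp [h0]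
  · refine (measure_mono fun y hy => ?_).trans_lt
      (measure_closedBall_lt_top (x := x) (r := d * h))
    exact mem_closedBall_iff_norm.2 (norm_sub_le_of_mem_gridCell hh hx hy)

/-- The function which is equal on each cube of the grid to the mean value of `φ` there. -/
noncomputable def gridAverage (h : ℝ) (φ : EuclideanSpace ℝ (Fin d) → ℝ)
    (x : EuclideanSpace ℝ (Fin d)) : ℝ :=
  ⨍ y in gridCell h (gridIndex h x), φ y

/-- By Jensen's inequality on the cube `Q` containing `x`, together with
`Q ⊆ closedBall x (d h)` and `volume (ball 0 (h / 2)) ≤ volume Q`. -/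
theorem enorm_sub_gridAverage_sq_le (hh : 0 < h) {φ : EuclideanSpace ℝ (Fin d) → ℝ}
    (hφ : Continuous φ) (hi : Integrable φ) (x : EuclideanSpace ℝ (Fin d)) :
    ‖φ x - gridAverage h φ x‖ₑ ^ 2 ≤
      (volume (Metric.ball (0 : EuclideanSpace ℝ (Fin d)) (h / 2)))⁻¹ *
        ∫⁻ z in Metric.closedBall (0 : EuclideanSpace ℝ (Fin d)) (d * h),
          ‖φ (x + z) - φ x‖ₑ ^ 2 := by
  set Q := gridCell h (gridIndex h x) with hQ
  have hxQ : x ∈ Q := rfl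
  have hpos : 0 < volume (Metric.ball (0 : EuclideanSpace ℝ (Fin d)) (h / 2)) :=
    Metric.measure_ball_pos _ _ (by positivity)
  have hle := volume_ball_le_volume_gridCell hh (gridIndex h x)
  rw [← hQ] at hle
  have h0 : volume Q ≠ 0 := (hpos.trans_le hle).ne'
  have htop : volume Q ≠ ⊤ := (volume_gridCell_lt_top hh _).ne
  have hr : volume.real Q ≠ 0 := (ENNReal.toReal_pos h0 htop).ne'
  have havg : φ x - gridAverage h φ x = (volume.real Q)⁻¹ * ∫ y in Q, (φ x - φ y) := by
    have hconst : Integrable (fun _ => φ x) (volume.restrict Q) := integrableOn_const htop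
    rw [integral_sub hconst hi.integrableOn, gridAverage, setAverage_eq]
    simp only [setIntegral_const, smul_eq_mul]
    rw [mul_sub, inv_mul_cancel_left₀ hr]
  have henorm : ‖(volume.real Q)⁻¹‖ₑ = (volume Q)⁻¹ := by
    rw [Real.enorm_eq_ofReal (by positivity), ENNReal.ofReal_inv_of_pos (by positivity),
      ofReal_measureReal htop]
  have hmeas : Continuous fun y => φ x - φ y := continuous_const.sub hφ
  calc ‖φ x - gridAverage h φ x‖ₑ ^ 2
      = ((volume Q)⁻¹) ^ 2 * ‖∫ y in Q, (φ x - φ y)‖ₑ ^ 2 := by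
        rw [havg, enorm_mul, henorm, mul_pow]
    _ ≤ ((volume Q)⁻¹) ^ 2 * (volume Q * ∫⁻ y in Q, ‖φ x - φ y‖ₑ ^ 2) := by
        gcongr
        refine (pow_le_pow_left' (enorm_integral_le_lintegral_enorm _) 2).trans ?_
        refine (sq_lintegral_le_measure_univ_mul _ hmeas.enorm.aemeasurable).trans_eq ?_
        simp
    _ = (volume Q)⁻¹ * ∫⁻ y in Q, ‖φ x - φ y‖ₑ ^ 2 := by
        rw [pow_two, mul_assoc, ← mul_assoc _ (volume Q), ENNReal.inv_mul_cancel h0 htop, one_mul]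
    _ ≤ (volume (Metric.ball (0 : EuclideanSpace ℝ (Fin d)) (h / 2)))⁻¹ *
        ∫⁻ y in Metric.closedBall x (d * h), ‖φ x - φ y‖ₑ ^ 2 := by
        gcongr
        intro y hy
        exact mem_closedBall_iff_norm.2 (norm_sub_le_of_mem_gridCell hh hxQ hy)
    _ = _ := by
        congr 1
        rw [← lintegral_indicator measurableSet_closedBall,
          ← lintegral_indicator measurableSet_closedBall,
          ← lintegral_add_left_eq_self _ x]
        refine lintegral_congr fun z => ?_
        by_cases hz : z ∈ Metric.closedBall (0 : EuclideanSpace ℝ (Fin d)) (d * h)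
        · rw [Set.indicator_of_mem hz, Set.indicator_of_mem (by simpa using hz), ← enorm_neg,
            neg_sub]
        · rw [Set.indicator_of_notMem hz, Set.indicator_of_notMem (by simpa using hz)]

theorem enorm_fderiv_apply_sq_le (φ : EuclideanSpace ℝ (Fin d) → ℝ)
    (x z : EuclideanSpace ℝ (Fin d)) :
    ‖fderiv ℝ φ x z‖ₑ ^ 2 ≤
      ‖z‖ₑ ^ 2 * ∑ i, ‖fderiv ℝ φ x (EuclideanSpace.single i 1)‖ₑ ^ 2 := by
  have hreal : ‖fderiv ℝ φ x z‖ ^ 2 ≤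
      ‖z‖ ^ 2 * ∑ i, ‖fderiv ℝ φ x (EuclideanSpace.single i 1)‖ ^ 2 := by
    have hz : fderiv ℝ φ x z = ∑ i, z i * fderiv ℝ φ x (EuclideanSpace.single i 1) := by
      conv_lhs => rw [← (EuclideanSpace.basisFun (Fin d) ℝ).sum_repr z]
      simp [map_sum]
    rw [hz, EuclideanSpace.norm_sq_eq]
    simp only [Real.norm_eq_abs, sq_abs]
    exact Finset.sum_mul_sq_le_sq_mul_sq _ _ _
  have h := ENNReal.ofReal_le_ofReal hreal
  rw [ENNReal.ofReal_mul (by positivity), ENNReal.ofReal_sum_of_nonneg (fun i _ => by positivity)]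
    at h
  simpa only [ENNReal.ofReal_pow (norm_nonneg _), ofReal_norm] using h

/-- A Poincaré–Wirtinger inequality: the distance of `φ` to its grid average is at most a
constant times `h` times the norm of `∇φ`. The factor `(2d)^d` is the ratio of the volumes of
balls of radius `d h` and `h / 2`. -/
theorem lintegral_sub_gridAverage_sq_le [NeZero d] (hh : 0 < h) {φ : EuclideanSpace ℝ (Fin d) → ℝ}
    (hφ : ContDiff ℝ 1 φ) (hi : Integrable φ) :
    ∫⁻ x, ‖φ x - gridAverage h φ x‖ₑ ^ 2 ≤ (2 * d : ENNReal) ^ d * ENNReal.ofReal (d * h) ^ 2 *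
      ∫⁻ x, ∑ i, ‖fderiv ℝ φ x (EuclideanSpace.single i 1)‖ₑ ^ 2 := by
  set m := volume (Metric.ball (0 : EuclideanSpace ℝ (Fin d)) (h / 2)) with hm
  set B := Metric.closedBall (0 : EuclideanSpace ℝ (Fin d)) (d * h) with hB
  set D := ∫⁻ x, ∑ i, ‖fderiv ℝ φ x (EuclideanSpace.single i 1)‖ₑ ^ 2 with hD
  have hm0 : m ≠ 0 := (Metric.measure_ball_pos _ _ (by positivity)).ne'
  have hmtop : m ≠ ⊤ := measure_ball_lt_top.ne
  have hvol : volume B = (2 * d : ENNReal) ^ d * m := by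
    have e : (d * h : ℝ) = (2 * d) * (h / 2) := by ring
    rw [hB, hm, e, Measure.addHaar_closedBall_mul _ _ (by positivity) (by positivity),
      ← Measure.addHaar_closedBall_eq_addHaar_ball, finrank_euclideanSpace_fin,
      ENNReal.ofReal_pow (by positivity)]
    congr 2
    rw [ENNReal.ofReal_mul zero_le_two]
    simp
  have hz : ∀ z ∈ B, ∫⁻ x, ‖φ (x + z) - φ x‖ₑ ^ 2 ≤ ENNReal.ofReal (d * h) ^ 2 * D := by
    intro z hz
    refine (lintegral_translate_sub_sq_le hφ z).trans ?_
    refine (lintegral_mono fun x => enorm_fderiv_apply_sq_le φ x z).trans ?_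
    rw [lintegral_const_mul' _ _ (by finiteness)]
    gcongr
    rw [← ofReal_norm]
    exact ENNReal.ofReal_le_ofReal (mem_closedBall_zero_iff.1 hz)
  have hc : Measurable fun p : EuclideanSpace ℝ (Fin d) × EuclideanSpace ℝ (Fin d) =>
      ‖φ (p.1 + p.2) - φ p.1‖ₑ ^ 2 := by
    have := hφ.continuous
    exact ((this.comp (continuous_fst.add continuous_snd)).sub
      (this.comp continuous_fst)).enorm.measurable.pow_const 2
  calc ∫⁻ x, ‖φ x - gridAverage h φ x‖ₑ ^ 2
      ≤ ∫⁻ x, m⁻¹ * ∫⁻ z in B, ‖φ (x + z) - φ x‖ₑ ^ 2 :=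
        lintegral_mono fun x => enorm_sub_gridAverage_sq_le hh hφ.continuous hi x
    _ = m⁻¹ * ∫⁻ z in B, ∫⁻ x, ‖φ (x + z) - φ x‖ₑ ^ 2 := by
        rw [lintegral_const_mul' _ _ (ENNReal.inv_ne_top.2 hm0),
          lintegral_lintegral_swap hc.aemeasurable]
    _ ≤ m⁻¹ * ∫⁻ _z in B, ENNReal.ofReal (d * h) ^ 2 * D := by
        exact mul_le_mul_right (setLIntegral_mono' measurableSet_closedBall hz) _
    _ = _ := by
        rw [setLIntegral_const, hvol]
        calc _ = (2 * d : ENNReal) ^ d * ENNReal.ofReal (d * h) ^ 2 * D * (m⁻¹ * m) := by ring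
          _ = _ := by rw [ENNReal.inv_mul_cancel hm0 hmtop, mul_one]

end Grid

section Approx

variable {d : ℕ} (Ω : BoundedOpenSet d)

theorem enorm_sq_eq_lintegral {α : Type*} [MeasurableSpace α] {μ : Measure α} (u : Lp ℝ 2 μ) :
    ‖u‖ₑ ^ 2 = ∫⁻ x, ‖u x‖ₑ ^ 2 ∂μ := by
  rw [Lp.enorm_def, eLpNorm_eq_lintegral_rpow_enorm_toReal two_ne_zero ENNReal.ofNat_ne_top,
    ← ENNReal.rpow_two, ← ENNReal.rpow_mul]
  simp

theorem enorm_testL2_sq (φ : Test Ω) : ‖testL2 Ω φ‖ₑ ^ 2 = ∫⁻ x, ‖φ x‖ₑ ^ 2 := by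
  rw [enorm_sq_eq_lintegral]
  have h : ∫⁻ x in (Ω.toOpens : Set (EuclideanSpace ℝ (Fin d))), ‖φ x‖ₑ ^ 2
      = ∫⁻ x, ‖φ x‖ₑ ^ 2 := by
    refine setLIntegral_eq_of_support_subset ?_
    intro x hx
    by_contra hxΩ
    have : φ x = 0 := image_eq_zero_of_notMem_tsupport fun h => hxΩ (φ.tsupport_subset h)
    simp [this] at hx
  rw [← h]
  refine lintegral_congr_ae ?_
  filter_upwards [(memLp_test Ω φ).coeFn_toLp] with x hx
  simp only [testL2, LinearMap.coe_mk, AddHom.coe_mk, hx]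

theorem enorm_testGrad_sq (φ : Test Ω) : ‖testGrad Ω φ‖ₑ ^ 2 =
    ∫⁻ x, ∑ i, ‖fderiv ℝ φ x (EuclideanSpace.single i 1)‖ₑ ^ 2 := by
  have h1 : ‖testGrad Ω φ‖ₑ ^ 2 = ∑ i, ‖testGrad Ω φ i‖ₑ ^ 2 := by
    simp only [← ofReal_norm, ← ENNReal.ofReal_pow (norm_nonneg _)]
    rw [PiLp.norm_sq_eq_of_L2, ENNReal.ofReal_sum_of_nonneg (fun i _ => by positivity)]
  rw [h1, lintegral_finsetSum]
  · refine Finset.sum_congr rfl fun i _ => ?_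
    refine (enorm_testL2_sq Ω _).trans ?_
    simp only [lineDeriv_test_apply]
  · intro i _
    have hc : Continuous (∂_{EuclideanSpace.single i (1 : ℝ)} φ : Test Ω) :=
      (∂_{EuclideanSpace.single i (1 : ℝ)} φ : Test Ω).continuous
    have := hc.enorm.measurable.pow_const 2
    simpa only [lineDeriv_test_apply] using this

/-- Test functions are approximated in `L²(Ω)`, uniformly on bounded sets of `H¹₀(Ω)`, by step
functions on a fixed grid. -/
theorem exists_finiteDimensional_approx_test [NeZero d] {ε : ℝ} (hε : 0 < ε) :
    ∃ W : Submodule ℝ (L2 Ω), FiniteDimensional ℝ W ∧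
      ∀ φ : Test Ω, ∃ g ∈ W, ‖testL2 Ω φ - g‖ ≤ ε * ‖testGrad Ω φ‖ := by
  classical
  set a : ℝ := (2 * d : ℝ) ^ d * (d : ℝ) ^ 2 + 1 with ha
  have ha1 : 1 ≤ a := by rw [ha]; linarith [show 0 ≤ (2 * d : ℝ) ^ d * (d : ℝ) ^ 2 by positivity]
  -- this side length makes the constant `(2d)^d (dh)²` at most `ε²`
  set h : ℝ := ε / a with hh'
  have hh : 0 < h := by positivity
  obtain ⟨R, _, hR⟩ := Ω.bounded.exists_pos_norm_le
  let μ : Measure (EuclideanSpace ℝ (Fin d)) :=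
    volume.restrict (Ω.toOpens : Set (EuclideanSpace ℝ (Fin d)))
  have hfin : ∀ k, μ (gridCell h k) ≠ ⊤ := fun k =>
    ((Measure.restrict_apply_le _ _).trans_lt (volume_gridCell_lt_top hh k)).ne
  let b : (Fin d → ℤ) → L2 Ω := fun k =>
    indicatorConstLp 2 (measurableSet_gridCell k) (hfin k) (1 : ℝ)
  -- only finitely many cubes meet the bounded set `Ω`
  let S : Finset (Fin d → ℤ) := Fintype.piFinset fun _ => Finset.Icc ⌊-R / h⌋ ⌊R / h⌋
  have hS : ∀ x ∈ (Ω.toOpens : Set (EuclideanSpace ℝ (Fin d))), gridIndex h x ∈ S := by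
    intro x hx
    refine Fintype.mem_piFinset.2 fun i => Finset.mem_Icc.2 ?_
    have h1 : |x i| ≤ R := (PiLp.norm_apply_le x i).trans (hR x hx)
    rw [abs_le] at h1
    exact ⟨Int.floor_le_floor (div_le_div_of_nonneg_right h1.1 hh.le),
      Int.floor_le_floor (div_le_div_of_nonneg_right h1.2 hh.le)⟩
  refine ⟨Submodule.span ℝ (S.image b), FiniteDimensional.span_finset ℝ _, fun φ => ?_⟩
  let g : L2 Ω := ∑ k ∈ S, (⨍ y in gridCell h k, φ y) • b k
  refine ⟨g, Submodule.sum_mem _ fun k hk => Submodule.smul_mem _ _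
    (Submodule.subset_span (by simpa using ⟨k, hk, rfl⟩)), ?_⟩
  have hb : ∀ k, ⇑(b k) =ᵐ[μ] (gridCell h k).indicator fun _ => (1 : ℝ) :=
    fun k => indicatorConstLp_coeFn
  have hg : ⇑g =ᵐ[μ] gridAverage h φ := by
    have h1 : ⇑g =ᵐ[μ] ∑ k ∈ S, ⇑((⨍ y in gridCell h k, φ y) • b k) := Lp.coeFn_finsetSum _ _
    have h2 : ∀ᵐ x ∂μ, ∀ k, ((⨍ y in gridCell h k, φ y) • b k : L2 Ω) x
        = (⨍ y in gridCell h k, φ y) * (gridCell h k).indicator (fun _ => (1 : ℝ)) x := by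
      rw [ae_all_iff]
      intro k
      filter_upwards [Lp.coeFn_smul (⨍ y in gridCell h k, φ y) (b k), hb k] with x hx hx'
      rw [hx, Pi.smul_apply, hx', smul_eq_mul]
    filter_upwards [h1, h2, ae_restrict_mem Ω.toOpens.isOpen.measurableSet] with x hx1 hx2 hxΩ
    rw [hx1, Finset.sum_apply, Finset.sum_congr rfl fun k _ => hx2 k,
      Finset.sum_eq_single (gridIndex h x)]
    · rw [Set.indicator_of_mem (show x ∈ gridCell h (gridIndex h x) from rfl), mul_one]
      rfl
    · intro k _ hk
      rw [Set.indicator_of_notMem (fun hx => hk hx.symm), mul_zero]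
    · exact fun hn => absurd (hS x hxΩ) hn
  have hφ1 : ContDiff ℝ 1 φ := φ.contDiff.of_le (by simp)
  have hφi : Integrable φ := φ.continuous.integrable_of_hasCompactSupport φ.hasCompactSupport
  have key : ‖testL2 Ω φ - g‖ₑ ^ 2 ≤
      (2 * d : ENNReal) ^ d * ENNReal.ofReal (d * h) ^ 2 * ‖testGrad Ω φ‖ₑ ^ 2 := by
    rw [enorm_testGrad_sq, enorm_sq_eq_lintegral]
    refine le_trans ?_ (lintegral_sub_gridAverage_sq_le hh hφ1 hφi)
    refine le_trans (le_of_eq ?_) (setLIntegral_le_lintegral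
      (Ω.toOpens : Set (EuclideanSpace ℝ (Fin d))) _)
    refine lintegral_congr_ae ?_
    filter_upwards [Lp.coeFn_sub (testL2 Ω φ) g, (memLp_test Ω φ).coeFn_toLp, hg] with x h1 h2 h3
    rw [h1, Pi.sub_apply, h3]
    simp only [testL2, LinearMap.coe_mk, AddHom.coe_mk, h2]
  have hcon : (2 * d : ENNReal) ^ d * ENNReal.ofReal (d * h) ^ 2 ≤ ENNReal.ofReal ε ^ 2 := by
    have e : (2 * d : ENNReal) ^ d * ENNReal.ofReal (d * h) ^ 2
        = ENNReal.ofReal ((2 * d : ℝ) ^ d * (d * h) ^ 2) := by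
      have e2 : (2 * d : ENNReal) = ENNReal.ofReal (2 * d) := by
        rw [ENNReal.ofReal_mul zero_le_two, ENNReal.ofReal_ofNat, ENNReal.ofReal_natCast]
      rw [e2, ← ENNReal.ofReal_pow (by positivity), ← ENNReal.ofReal_pow (by positivity),
        ← ENNReal.ofReal_mul (by positivity)]
    rw [e, ← ENNReal.ofReal_pow hε.le]
    refine ENNReal.ofReal_le_ofReal ?_
    have e2 : (2 * d : ℝ) ^ d * (d * h) ^ 2 = (a - 1) / a ^ 2 * ε ^ 2 := by
      rw [hh', ha]; field_simp; ring
    rw [e2]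
    have h1 : (a - 1) / a ^ 2 ≤ 1 := by
      rw [div_le_one (by positivity)]; nlinarith
    nlinarith [sq_nonneg ε]
  have key2 : ‖testL2 Ω φ - g‖ₑ ^ 2 ≤ (ENNReal.ofReal ε * ‖testGrad Ω φ‖ₑ) ^ 2 := by
    rw [mul_pow]
    exact key.trans (by gcongr)
  have key3 := (ENNReal.pow_le_pow_left_iff two_ne_zero).1 key2
  rw [← ofReal_norm, ← ofReal_norm, ← ENNReal.ofReal_mul hε.le] at key3
  exact (ENNReal.ofReal_le_ofReal_iff (by positivity)).1 key3

end Approx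

/-! ### Eigenbases of compact positive operators -/

/-- A linear order in which there are infinitely many elements but only finitely many below each
is that of the natural numbers. -/
theorem exists_equiv_nat_monotone {ι : Type*} [LinearOrder ι] [Infinite ι]
    (hfin : ∀ i : ι, (Set.Iio i).Finite) : ∃ e : ℕ ≃ ι, Monotone e := by
  let r : ι → ℕ := fun i => (Set.Iio i).ncard
  have hr : StrictMono r := fun i j hij =>
    Set.ncard_lt_ncard (Set.Iio_ssubset_Iio hij) (hfin j)
  -- the rank of an element is surjective: its range is infinite and downward closed
  have hdown : ∀ n, n + 1 ∈ Set.range r → n ∈ Set.range r := by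
    rintro n ⟨i, hi⟩
    have hne : (Set.Iio i).Nonempty := by
      rw [← Set.ncard_pos (hfin i)]; change 0 < r i; omega
    obtain ⟨j, hj, hmax⟩ := (hfin i).exists_maximal hne
    refine ⟨j, ?_⟩
    have hins : Set.Iio i = insert j (Set.Iio j) := by
      ext k
      simp only [Set.mem_Iio, Set.mem_insert_iff]
      constructor
      · intro hk
        rcases lt_trichotomy k j with h | h | h
        · exact Or.inr h
        · exact Or.inl h
        · exact absurd (hmax hk h.le) (not_le.2 h)
      · rintro (rfl | h)
        · exact hj
        · exact h.trans hj
    have : r i = r j + 1 := by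
      change (Set.Iio i).ncard = _
      rw [hins, Set.ncard_insert_of_notMem (by simp) (hfin j)]
    omega
  have hsurj : Function.Surjective r := by
    intro n
    obtain ⟨m, hm, hnm⟩ := (Set.infinite_range_of_injective hr.injective).exists_gt n
    have hall : ∀ k, ∀ l, l + k ∈ Set.range r → l ∈ Set.range r := by
      intro k
      induction k with
      | zero => exact fun l hl => hl
      | succ k ih => exact fun l hl => ih l (hdown _ hl)
    exact hall (m - n) n (by rwa [Nat.add_sub_cancel' hnm.le])
  let e : ι ≃ ℕ := Equiv.ofBijective r ⟨hr.injective, hsurj⟩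
  refine ⟨e.symm, fun m n hmn => hr.le_iff_le.1 ?_⟩
  change e (e.symm m) ≤ e (e.symm n)
  simpa using hmn

/-- A family of positive numbers with finitely many members above each positive threshold
can be listed in nonincreasing order. -/
theorem exists_equiv_nat_antitone {ι : Type*} [Infinite ι] {f : ι → ℝ} (hpos : ∀ i, 0 < f i)
    (hfin : ∀ c > 0, {i | c ≤ f i}.Finite) : ∃ e : ℕ ≃ ι, Antitone (f ∘ e) := by
  classical
  obtain ⟨ho⟩ : Nonempty (LinearOrder ι) := ⟨linearOrderOfSTO WellOrderingRel⟩
  -- order the indices by decreasing value, ties being broken by an arbitrary linear order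
  let g : ι → ℝᵒᵈ ×ₗ ι := fun i => toLex (OrderDual.toDual (f i), i)
  have hg : Function.Injective g := fun i j hij => by
    have := congrArg (fun p => (ofLex p).2) hij
    exact this
  have hle : ∀ i j : ι, g i ≤ g j → f j ≤ f i := by
    intro i j hij
    rcases Prod.Lex.le_iff.1 hij with h | h
    · exact (OrderDual.toDual_lt_toDual.1 h).le
    · exact (OrderDual.toDual.injective h.1).ge
  let I : LinearOrder ι := LinearOrder.lift' g hg
  obtain ⟨e, he⟩ := @exists_equiv_nat_monotone ι I _ fun i =>
    (hfin (f i) (hpos i)).subset fun j hj => hle j i (@le_of_lt _ I.toPreorder _ _ hj)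
  exact ⟨e, fun m n hmn => hle _ _ (he hmn)⟩

section Spectral

universe u

variable {H : Type u} [NormedAddCommGroup H] [InnerProductSpace ℝ H]

/-- Along an orthonormal family of eigenvectors of a compact operator only finitely many
eigenvalues lie above a given positive threshold. -/
theorem finite_setOf_le_eigenvalue {T : H →L[ℝ] H} (hT : IsCompactOperator T) {ι : Type*}
    {v : ι → H} (hv : Orthonormal ℝ v) {f : ι → ℝ} (hf : ∀ i, T (v i) = f i • v i) {c : ℝ}
    (hc : 0 < c) : {i | c ≤ f i}.Finite := by
  have hK := hT.isCompact_closure_image_closedBall (f := (T : H →ₗ[ℝ] H)) 1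
  obtain ⟨t, ht, hcov⟩ := Metric.totallyBounded_iff.1 hK.totallyBounded (c / 2) (by positivity)
  have hmem : ∀ i, ∃ y ∈ t, dist (T (v i)) y < c / 2 := by
    intro i
    have h1 : T (v i) ∈ closure (T '' Metric.closedBall 0 1) :=
      subset_closure ⟨v i, by simp [hv.1 i], rfl⟩
    simpa using hcov h1
  choose y hyt hy using hmem
  refine Set.Finite.of_injOn (f := y) (t := t) (fun i _ => hyt i) ?_ ht
  intro i hi j hj hij
  by_contra hne
  have hd : dist (T (v i)) (T (v j)) < c := by
    have h2 := hy j
    rw [← hij] at h2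
    linarith [dist_triangle_right (T (v i)) (T (v j)) (y i), hy i]
  -- the images of two such vectors are orthogonal, hence at distance more than `c`
  have hsq : ‖T (v i) - T (v j)‖ ^ 2 = f i ^ 2 + f j ^ 2 := by
    rw [hf, hf, norm_sub_sq_real, norm_smul, norm_smul, hv.1 i, hv.1 j, real_inner_smul_left,
      real_inner_smul_right, hv.2 hne]
    simp
  have hi' : c ≤ f i := hi
  have hj' : c ≤ f j := hj
  rw [dist_eq_norm] at hd
  nlinarith [norm_nonneg (T (v i) - T (v j)), sq_nonneg (f j)]

theorem exists_hilbertBasis_eigenvectors [CompleteSpace H] {T : H →L[ℝ] H} (hT : IsCompactOperator T)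
    (hs : (T : H →ₗ[ℝ] H).IsSymmetric) :
    ∃ (ι : Type u) (b : HilbertBasis ι ℝ H) (f : ι → ℝ), ∀ i, T (b i) = f i • b i := by
  have hVc : ∀ μ, CompleteSpace (Module.End.eigenspace (T : Module.End ℝ H) μ) := fun μ => by
    have e : (Module.End.eigenspace (T : Module.End ℝ H) μ : Set H) = {x | T x = μ • x} := by
      ext x; exact Module.End.mem_eigenspace_iff
    have : IsClosed (Module.End.eigenspace (T : Module.End ℝ H) μ : Set H) := by
      rw [e]
      exact isClosed_eq T.continuous (continuous_const_smul μ)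
    exact this.completeSpace_coe
  choose w bw _ using fun μ =>
    exists_hilbertBasis ℝ (Module.End.eigenspace (T : Module.End ℝ H) μ)
  have hon : Orthonormal ℝ fun a : Σ μ, w μ => (bw a.1 a.2 : H) :=
    hs.orthogonalFamily_eigenspaces.orthonormal_sigma_orthonormal
      (fun μ => (bw μ).orthonormal)
  have hsp : (Submodule.span ℝ (Set.range fun a : Σ μ, w μ => (bw a.1 a.2 : H)))ᗮ = ⊥ := by
    rw [eq_bot_iff, ← ContinuousLinearMap.orthogonalComplement_iSup_eigenspaces_eq_bot hT hs]
    refine (Submodule.le_orthogonal_orthogonal _).trans (Submodule.orthogonal_le ?_)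
    refine iSup_le fun μ u hu => (Submodule.mem_orthogonal' _ _).2 fun x hx => ?_
    -- the vectors of the eigenspace orthogonal to `x` form a closed subspace that contains
    -- a Hilbert basis of the eigenspace
    let K := LinearMap.ker ((innerSL ℝ x).comp
      (Module.End.eigenspace (T : Module.End ℝ H) μ).subtypeL : _ →L[ℝ] ℝ).toLinearMap
    have hK : (⊤ : Submodule ℝ (Module.End.eigenspace (T : Module.End ℝ H) μ)) ≤ K := by
      rw [← (bw μ).dense_span]
      refine Submodule.topologicalClosure_minimal _ (Submodule.span_le.2 ?_)
        (ContinuousLinearMap.isClosed_ker _)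
      rintro _ ⟨i, rfl⟩
      exact (Submodule.mem_orthogonal' _ _).1 hx _ (Submodule.subset_span ⟨⟨μ, i⟩, rfl⟩)
    exact (real_inner_comm x u).trans (hK (Submodule.mem_top (x := ⟨u, hu⟩)))
  refine ⟨Σ μ, w μ, HilbertBasis.mkOfOrthogonalEqBot hon hsp, fun a => a.1, fun a => ?_⟩
  rw [HilbertBasis.coe_mkOfOrthogonalEqBot]
  exact Module.End.mem_eigenspace_iff.1 (bw a.1 a.2).2

/-- The spectral theorem for compact positive injective operators: there is an orthonormal basis
of eigenvectors, with eigenvalues decreasing to zero. -/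
theorem exists_hilbertBasis_nat_antitone [CompleteSpace H] {T : H →L[ℝ] H} (hT : IsCompactOperator T)
    (hs : (T : H →ₗ[ℝ] H).IsSymmetric) (hpos : ∀ x ≠ 0, 0 < ⟪T x, x⟫_ℝ)
    (hinf : ¬ FiniteDimensional ℝ H) :
    ∃ (e : HilbertBasis ℕ ℝ H) (μ : ℕ → ℝ), (∀ n, 0 < μ n) ∧ Antitone μ ∧
      Tendsto μ atTop (𝓝 0) ∧ ∀ n, T (e n) = μ n • e n := by
  obtain ⟨ι, b, f, hf⟩ := exists_hilbertBasis_eigenvectors hT hs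
  have hfpos : ∀ i, 0 < f i := fun i => by
    have h1 := hpos (b i) (b.orthonormal.ne_zero i)
    rwa [hf, real_inner_smul_left, real_inner_self_eq_norm_sq, b.orthonormal.1 i, one_pow,
      mul_one] at h1
  have hfin : ∀ c > 0, {i | c ≤ f i}.Finite := fun c hc =>
    finite_setOf_le_eigenvalue hT b.orthonormal hf hc
  have : Infinite ι := by
    by_contra hι
    rw [not_infinite_iff_finite] at hι
    have := Fintype.ofFinite ι
    exact hinf (Module.Basis.finiteDimensional_of_finite b.toOrthonormalBasis.toBasis)
  obtain ⟨e, he⟩ := exists_equiv_nat_antitone hfpos hfin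
  have hon : Orthonormal ℝ (b ∘ e) := b.orthonormal.comp _ e.injective
  refine ⟨HilbertBasis.mk hon ?_, f ∘ e, fun n => hfpos _, he, ?_, fun n => ?_⟩
  · rw [e.surjective.range_comp]
    exact b.dense_span.ge
  · rw [Metric.tendsto_atTop]
    intro c hc
    have hN : ((e : ℕ → ι) ⁻¹' {i | c ≤ f i}).Finite := (hfin c hc).preimage e.injective.injOn
    obtain ⟨N, hN⟩ := hN.bddAbove
    refine ⟨N + 1, fun n hn => ?_⟩
    rw [Real.dist_eq, sub_zero, Function.comp_apply, abs_of_pos (hfpos _)]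
    by_contra! hcn
    have := hN (show n ∈ _ from hcn)
    omega
  · rw [HilbertBasis.coe_mk]
    exact hf _

/-- The eigenvalues of an operator that is diagonal in a Hilbert basis are its diagonal entries. -/
theorem isEigenvalue_iff_mem_range {T : H →L[ℝ] H} (hs : (T : H →ₗ[ℝ] H).IsSymmetric)
    {ι : Type*} (e : HilbertBasis ι ℝ H) {μ : ι → ℝ} (h : ∀ n, T (e n) = μ n • e n) (l : ℝ) :
    IsEigenvalue T l ↔ l ∈ Set.range μ := by
  constructor
  · intro hl
    obtain ⟨x, hx⟩ := hl.exists_hasEigenvector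
    have hTx : T x = l • x := hx.apply_eq_smul
    by_contra hn
    refine hx.2 (e.repr.map_eq_zero_iff.1 ?_)
    ext n
    have h1 : ⟪T (e n), x⟫_ℝ = ⟪e n, T x⟫_ℝ := hs (e n) x
    rw [h, hTx, real_inner_smul_left, real_inner_smul_right] at h1
    have h2 : (μ n - l) * ⟪e n, x⟫_ℝ = 0 := by linarith
    rcases mul_eq_zero.1 h2 with h3 | h3
    · exact absurd ⟨n, by linarith⟩ hn
    · simpa [e.repr_apply_apply] using h3
  · rintro ⟨n, rfl⟩
    exact Module.End.hasEigenvalue_of_hasEigenvector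
      ⟨Module.End.mem_eigenspace_iff.2 (h n), e.orthonormal.ne_zero n⟩

end Spectral

/-! ### The inverse Laplacian -/

section LaplacianInv

variable {d : ℕ} [NeZero d] (Ω : BoundedOpenSet d)

theorem laplacianInv_mem_graph (f : L2 Ω) : (laplacianInv Ω f, f) ∈ laplacianGraph Ω := by
  have h := laplacian_mem_graph Ω ((laplacianIso Ω).symm f)
  have h2 : dirichletLaplacian Ω ((laplacianIso Ω).symm f) = f :=
    (laplacianIso Ω).apply_symm_apply f
  rw [h2] at h
  exact h

theorem laplacianInv_isSymmetric : (laplacianInv Ω : L2 Ω →ₗ[ℝ] L2 Ω).IsSymmetric := by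
  intro f g
  obtain ⟨F, hF, hf⟩ := (mem_laplacianGraph Ω).1 (laplacianInv_mem_graph Ω f)
  obtain ⟨G, hG, hg⟩ := (mem_laplacianGraph Ω).1 (laplacianInv_mem_graph Ω g)
  have h1 : ⟪G, F⟫_ℝ = ⟪g, laplacianInv Ω f⟫_ℝ := laplacianGraph_weak Ω hg (w := WithLp.toLp 2 (_, F)) hF
  have h2 : ⟪F, G⟫_ℝ = ⟪f, laplacianInv Ω g⟫_ℝ := laplacianGraph_weak Ω hf (w := WithLp.toLp 2 (_, G)) hG
  change ⟪laplacianInv Ω f, g⟫_ℝ = ⟪f, laplacianInv Ω g⟫_ℝ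
  rw [← h2, real_inner_comm, ← h1, real_inner_comm]

theorem adjoint_laplacianInv : ContinuousLinearMap.adjoint (laplacianInv Ω) = laplacianInv Ω :=
  (ContinuousLinearMap.eq_adjoint_iff _ _).2 (fun f g => laplacianInv_isSymmetric Ω f g) |>.symm

theorem eq_zero_of_laplacianInv_eq_zero {f : L2 Ω} (h : laplacianInv Ω f = 0) : f = 0 :=
  laplacianGraph_single_valued Ω _ (laplacianInv_mem_graph Ω f) h

/-- **Rellich's theorem**, in the form of a uniform finite-dimensional approximation of the
unit ball of `H¹₀(Ω)`. -/
theorem exists_finiteDimensional_approx {ε : ℝ} (hε : 0 < ε) :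
    ∃ W : Submodule ℝ (L2 Ω), ∃ _ : FiniteDimensional ℝ W,
      ∀ w ∈ H10Graph Ω, ‖w.fst - W.starProjection w.fst‖ ≤ ε * ‖w.snd‖ := by
  obtain ⟨W, hW, h⟩ := exists_finiteDimensional_approx_test Ω hε
  refine ⟨W, hW, fun w hw => ?_⟩
  refine H10Graph_induction Ω (P := fun u G => ‖u - W.starProjection u‖ ≤ ε * ‖G‖)
    (isClosed_le (by fun_prop) (by fun_prop)) (fun φ => ?_) hw
  obtain ⟨g, hg, hle⟩ := h φ
  refine le_trans ?_ hle
  rw [Submodule.starProjection_minimal]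
  exact ciInf_le ⟨0, by rintro _ ⟨_, rfl⟩; positivity⟩ (⟨g, hg⟩ : W)

theorem isCompactOperator_laplacianInv : IsCompactOperator (laplacianInv Ω) := by
  obtain ⟨C, hC, hpoin⟩ := exists_poincare Ω
  refine isClosed_setOfPred_isCompactOperator.closure_subset
    (Metric.mem_closure_iff.2 fun ε hε => ?_)
  obtain ⟨W, hW, happ⟩ := exists_finiteDimensional_approx Ω (ε := ε / (2 * (C + 1)))
    (by positivity)
  refine ⟨W.starProjection ∘L laplacianInv Ω, ?_, ?_⟩
  · let Q : L2 Ω →L[ℝ] W := W.orthogonalProjectionOnto ∘L laplacianInv Ω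
    have : LocallyCompactSpace W := by
      have := FiniteDimensional.proper_real W
      infer_instance
    have h1 : IsCompactOperator Q := isCompactOperator_of_locallyCompactSpace_dom Q
    exact h1.clm_comp W.subtypeL
  · rw [dist_eq_norm]
    refine lt_of_le_of_lt (ContinuousLinearMap.opNorm_le_bound _ (M := ε / 2) (by positivity)
      fun f => ?_) (by linarith)
    obtain ⟨G, hG, hf⟩ := (mem_laplacianGraph Ω).1 (laplacianInv_mem_graph Ω f)
    have h1 : ‖laplacianInv Ω f - W.starProjection (laplacianInv Ω f)‖
      ≤ ε / (2 * (C + 1)) * ‖G‖ := happ (WithLp.toLp 2 (laplacianInv Ω f, G)) hG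
    have h2 : ‖laplacianInv Ω f‖ ≤ C * ‖G‖ :=
      hpoin (WithLp.toLp 2 (laplacianInv Ω f, G)) hG
    have h3 : ⟪G, G⟫_ℝ = ⟪f, laplacianInv Ω f⟫_ℝ := laplacianGraph_weak Ω hf (w := WithLp.toLp 2 (_, G)) hG
    have h4 : ‖G‖ ≤ C * ‖f‖ := by
      have h5 := real_inner_le_norm f (laplacianInv Ω f)
      rw [← h3, real_inner_self_eq_norm_sq] at h5
      have h6 := mul_le_mul_of_nonneg_left h2 (norm_nonneg f)
      rcases (norm_nonneg G).eq_or_lt with h0 | h0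
      · rw [← h0]; positivity
      · exact le_of_mul_le_mul_right (by nlinarith) h0
    change ‖laplacianInv Ω f - W.starProjection (laplacianInv Ω f)‖ ≤ _
    calc _ ≤ ε / (2 * (C + 1)) * ‖G‖ := h1
      _ ≤ ε / (2 * (C + 1)) * ((C + 1) * ‖f‖) := by
          gcongr
          nlinarith [norm_nonneg f]
      _ = ε / 2 * ‖f‖ := by field_simp

/-- The indicators of a sequence of disjoint nonempty open subsets of `Ω` are independent. -/
theorem not_finiteDimensional_L2 : ¬ FiniteDimensional ℝ (L2 Ω) := by
  intro hfd
  obtain ⟨x, hx⟩ := Ω.nonempty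
  have hinf : Infinite (Ω.toOpens : Set (EuclideanSpace ℝ (Fin d))) :=
    (infinite_of_mem_nhds x (Ω.toOpens.isOpen.mem_nhds hx)).to_subtype
  obtain ⟨U, hUinf, hUo, hUd⟩ :=
    exists_seq_infinite_isOpen_pairwise_disjoint (Ω.toOpens : Set (EuclideanSpace ℝ (Fin d)))
  let V : ℕ → Set (EuclideanSpace ℝ (Fin d)) := fun n => Subtype.val '' U n
  have hVo : ∀ n, IsOpen (V n) := fun n =>
    Ω.toOpens.isOpen.isOpenEmbedding_subtypeVal.isOpenMap _ (hUo n)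
  have hVΩ : ∀ n, V n ⊆ Ω.toOpens := by rintro n _ ⟨y, _, rfl⟩; exact y.2
  have hVd : ∀ m n, m ≠ n → V m ∩ V n = ∅ := fun m n hmn =>
    Set.disjoint_iff_inter_eq_empty.1 ((hUd hmn).image Subtype.val_injective.injOn
      (Set.subset_univ _) (Set.subset_univ _))
  let μ := volume.restrict (Ω.toOpens : Set (EuclideanSpace ℝ (Fin d)))
  have hfin : IsFiniteMeasure μ := ⟨by
    simpa [μ] using Ω.bounded.measure_lt_top⟩
  have hne : ∀ n, μ.real (V n) ≠ 0 := fun n => by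
    have h1 : μ (V n) = volume (V n) := Measure.restrict_eq_self _ (hVΩ n)
    have h2 : 0 < volume (V n) := (hVo n).measure_pos _ ((hUinf n).nonempty.image _)
    exact (ENNReal.toReal_pos (by rw [h1]; exact h2.ne') (measure_ne_top _ _)).ne'
  let v : ℕ → L2 Ω := fun n =>
    indicatorConstLp 2 (hVo n).measurableSet (measure_ne_top μ _) (1 : ℝ)
  have hin : ∀ m n, ⟪v m, v n⟫_ℝ = μ.real (V m ∩ V n) := fun m n =>
    L2.real_inner_indicatorConstLp_one_indicatorConstLp_one _ _ _ _
  have hli : LinearIndependent ℝ v := by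
    refine linearIndependent_of_ne_zero_of_inner_eq_zero (fun n h0 => hne n ?_) fun m n hmn => ?_
    · rw [← Set.inter_self (V n), ← hin n n, h0, inner_zero_left]
    · exact (hin m n).trans (by rw [hVd m n hmn, measureReal_empty])
  exact Module.Finite.not_linearIndependent_of_infinite v hli

end LaplacianInv

/-! ### The transformed operator -/

section Transformed

variable {d : ℕ} [NeZero d] (Ω : BoundedOpenSet d)

theorem transformedOperator_apply (f g : L2 Ω) :
    transformedOperator Ω (WithLp.toLp 2 (f, g)) =
      WithLp.toLp 2 (f + laplacianInv Ω (laplacianInv Ω f) - g, -f + g) := by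
  -- `𝒢 𝒯⁻¹ (p, q) = (p - q, A⁻¹ p)`, and `B* B` is determined by `⟪B x, B y⟫`
  have hB : ∀ p q : L2 Ω, aaoOperator Ω ((aaoTransform Ω).symm (WithLp.toLp 2 (p, q)))
      = WithLp.toLp 2 (p - q, laplacianInv Ω p) := by
    intro p q
    have h1 : laplacianIso Ω ((laplacianIso Ω).symm p) = p := (laplacianIso Ω).apply_symm_apply p
    change WithLp.toLp 2 (laplacianIso Ω ((laplacianIso Ω).symm p) - q, laplacianInv Ω p) = _
    rw [h1]
  refine ext_inner_right ℝ fun y => ?_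
  obtain ⟨⟨p, q⟩, rfl⟩ := (WithLp.equiv 2 (L2 Ω × L2 Ω)).symm.surjective y
  have h1 : ⟪transformedOperator Ω (WithLp.toLp 2 (f, g)), WithLp.toLp 2 (p, q)⟫_ℝ =
      ⟪aaoOperator Ω ((aaoTransform Ω).symm (WithLp.toLp 2 (f, g))),
        aaoOperator Ω ((aaoTransform Ω).symm (WithLp.toLp 2 (p, q)))⟫_ℝ := by
    simp only [transformedOperator, ContinuousLinearMap.comp_apply]
    rw [ContinuousLinearMap.adjoint_inner_left, ContinuousLinearMap.adjoint_inner_left]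
    rfl
  have h2 : ⟪laplacianInv Ω (laplacianInv Ω f), p⟫_ℝ = ⟪laplacianInv Ω f, laplacianInv Ω p⟫_ℝ :=
    laplacianInv_isSymmetric Ω _ _
  refine h1.trans ?_
  rw [hB, hB]
  simp only [WithLp.prod_inner_apply, WithLp.equiv_symm_apply]
  simp only [inner_sub_left, inner_add_left, inner_neg_left, inner_sub_right, h2]
  ring

end Transformed

/-! ### The characteristic quadratic -/

section Roots

theorem upperRoot_add_lowerRoot (μ : ℝ) : upperRoot μ + lowerRoot μ = 2 + μ := by
  simp only [upperRoot, lowerRoot]; ring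

theorem upperRoot_mul_lowerRoot (μ : ℝ) : upperRoot μ * lowerRoot μ = μ := by
  have h : √(1 + μ ^ 2 / 4) ^ 2 = 1 + μ ^ 2 / 4 := Real.sq_sqrt (by positivity)
  simp only [upperRoot, lowerRoot]
  linear_combination -h

theorem eq_upperRoot_or_eq_lowerRoot_iff {l μ : ℝ} :
    l = upperRoot μ ∨ l = lowerRoot μ ↔ l ^ 2 - (2 + μ) * l + μ = 0 := by
  have h : l ^ 2 - (2 + μ) * l + μ = (l - upperRoot μ) * (l - lowerRoot μ) := by
    linear_combination l * upperRoot_add_lowerRoot μ - upperRoot_mul_lowerRoot μ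
  rw [h, mul_eq_zero, sub_eq_zero, sub_eq_zero]

theorem continuous_upperRoot : Continuous upperRoot := by
  unfold upperRoot; fun_prop

theorem continuous_lowerRoot : Continuous lowerRoot := by
  unfold lowerRoot; fun_prop

theorem upperRoot_zero : upperRoot 0 = 2 := by norm_num [upperRoot]

theorem lowerRoot_zero : lowerRoot 0 = 0 := by norm_num [lowerRoot]

variable {μ : ℕ → ℝ}

theorem tendsto_upperRoot (hμ : Tendsto μ atTop (𝓝 0)) :
    Tendsto (fun n => upperRoot (μ n)) atTop (𝓝 2) := by
  rw [← upperRoot_zero]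
  exact (continuous_upperRoot.tendsto 0).comp hμ

theorem tendsto_lowerRoot (hμ : Tendsto μ atTop (𝓝 0)) :
    Tendsto (fun n => lowerRoot (μ n)) atTop (𝓝 0) := by
  conv => enter [3]; rw [← lowerRoot_zero]
  exact (continuous_lowerRoot.tendsto 0).comp hμ

theorem lowerRoot_ne_zero {m : ℝ} (hm : m ≠ 0) : lowerRoot m ≠ 0 := fun h => hm <| by
  rw [← upperRoot_mul_lowerRoot m, h, mul_zero]

/-- At `λ = 2` the quadratic takes the value `-μ`. -/
theorem upperRoot_ne_two {m : ℝ} (hm : m ≠ 0) : upperRoot m ≠ 2 := fun h => hm <| by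
  have := eq_upperRoot_or_eq_lowerRoot_iff.1 (Or.inl h.symm)
  linarith

theorem tendsto_lowerRoot_div (hμ : Tendsto μ atTop (𝓝 0)) (h0 : ∀ n, μ n ≠ 0) :
    Tendsto (fun n => lowerRoot (μ n) / μ n) atTop (𝓝 (1 / 2)) := by
  -- the product of the roots is `μ`
  have h : ∀ n, lowerRoot (μ n) / μ n = 1 / upperRoot (μ n) := fun n => by
    have h1 := lowerRoot_ne_zero (h0 n)
    have h2 := upperRoot_mul_lowerRoot (μ n)
    have h3 : upperRoot (μ n) ≠ 0 := fun h => h0 n (by rw [← h2, h, zero_mul])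
    rw [div_eq_div_iff (h0 n) h3]
    linarith
  simp only [h]
  exact tendsto_const_nhds.div (tendsto_upperRoot hμ) two_ne_zero

theorem tendsto_upperRoot_sub_two_div (hμ : Tendsto μ atTop (𝓝 0)) (h0 : ∀ n, μ n ≠ 0) :
    Tendsto (fun n => (upperRoot (μ n) - 2) / μ n) atTop (𝓝 (1 / 2)) := by
  -- the sum of the roots is `2 + μ`
  have h : ∀ n, (upperRoot (μ n) - 2) / μ n = 1 - lowerRoot (μ n) / μ n := fun n => by
    have h1 := h0 n
    have h2 := upperRoot_add_lowerRoot (μ n)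
    field_simp
    linarith
  simp only [h]
  have := (tendsto_const_nhds (x := (1 : ℝ))).sub (tendsto_lowerRoot_div hμ h0)
  norm_num at this ⊢
  exact this

end Roots

/-! ### Eigenvalues and eigenvectors -/

section Eigenpairs

variable {d : ℕ} [NeZero d] (Ω : BoundedOpenSet d)

/-- The second component of the eigenvalue equation expresses `f` through `g`; the first one is
then an equation for `g` alone. -/
theorem transformedOperator_eq_smul_iff {l : ℝ} {f g : L2 Ω} :
    transformedOperator Ω (WithLp.toLp 2 (f, g)) = l • WithLp.toLp 2 (f, g) ↔
      f = (1 - l) • g ∧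
        (1 - l) • laplacianInv Ω (laplacianInv Ω g) = (1 - (1 - l) ^ 2) • g := by
  rw [transformedOperator_apply, ← WithLp.toLp_smul, (WithLp.toLp_injective 2).eq_iff,
    Prod.smul_mk, Prod.mk.injEq, and_comm]
  have h1 : -f + g = l • g ↔ f = (1 - l) • g := by
    rw [sub_smul, one_smul, neg_add_eq_sub, sub_eq_iff_eq_add, eq_sub_iff_add_eq, add_comm f,
      eq_comm]
  rw [h1]
  refine and_congr_right fun hf => ?_
  rw [hf, map_smul, map_smul, ← sub_eq_zero, ← sub_eq_zero (a := (1 - l) • _)]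
  refine Eq.congr_left ?_
  module

/-- On the roots of the quadratic, the second equation for an eigenpair says that `g` is an
eigenvector of `A⁻²`. -/
theorem transformedOperator_eq_smul_iff_of_root {l μ : ℝ}
    (hl : l = upperRoot μ ∨ l = lowerRoot μ) {f g : L2 Ω} :
    transformedOperator Ω (WithLp.toLp 2 (f, g)) = l • WithLp.toLp 2 (f, g) ↔
      laplacianInv Ω (laplacianInv Ω g) = μ • g ∧ f = (1 - l) • g := by
  have hq := eq_upperRoot_or_eq_lowerRoot_iff.1 hl
  have hl1 : 1 - l ≠ 0 := fun h => by
    rw [show l = 1 by linarith] at hq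
    linarith
  rw [transformedOperator_eq_smul_iff, and_comm]
  refine and_congr_left fun _ => ?_
  rw [show 1 - (1 - l) ^ 2 = (1 - l) * μ by linear_combination -hq, mul_smul]
  exact (smul_right_injective _ hl1).eq_iff

theorem isEigenvalue_iff_exists_ne_zero {V : Type*} [NormedAddCommGroup V] [NormedSpace ℝ V]
    {B : V →L[ℝ] V} {l : ℝ} : IsEigenvalue B l ↔ ∃ x, x ≠ 0 ∧ B x = l • x := by
  constructor
  · intro h
    obtain ⟨x, hx⟩ := h.exists_hasEigenvector
    exact ⟨x, hx.2, hx.apply_eq_smul⟩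
  · rintro ⟨x, hx, h⟩
    exact Module.End.hasEigenvalue_of_hasEigenvector
      ⟨Module.End.mem_eigenspace_iff.2 h, hx⟩

theorem isEigenvalue_transformedOperator_iff {l : ℝ} :
    IsEigenvalue (transformedOperator Ω) l ↔
      ∃ μ : ℝ, IsEigenvalue (laplacianInv Ω ∘L laplacianInv Ω) μ ∧
        (l = upperRoot μ ∨ l = lowerRoot μ) := by
  constructor
  · intro h
    obtain ⟨x, hx0, hx⟩ := isEigenvalue_iff_exists_ne_zero.1 h
    obtain ⟨⟨f, g⟩, rfl⟩ := (WithLp.equiv 2 (L2 Ω × L2 Ω)).symm.surjective x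
    obtain ⟨hf, hg⟩ := (transformedOperator_eq_smul_iff Ω).1 hx
    have hg0 : g ≠ 0 := by
      rintro rfl
      rw [smul_zero] at hf
      exact hx0 (by rw [hf]; rfl)
    have hl1 : 1 - l ≠ 0 := fun h1 => by
      rw [h1, zero_smul] at hg
      exact hg0 (by simpa using hg.symm)
    refine ⟨(1 - l)⁻¹ * (1 - (1 - l) ^ 2), isEigenvalue_iff_exists_ne_zero.2 ⟨g, hg0, ?_⟩,
      eq_upperRoot_or_eq_lowerRoot_iff.2 (by field_simp; ring)⟩
    rw [mul_smul, ← hg, inv_smul_smul₀ hl1]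
    rfl
  · rintro ⟨μ, hμ, hl⟩
    obtain ⟨g, hg0, hg⟩ := isEigenvalue_iff_exists_ne_zero.1 hμ
    refine isEigenvalue_iff_exists_ne_zero.2 ⟨WithLp.toLp 2 ((1 - l) • g, g), fun h => hg0 ?_,
      (transformedOperator_eq_smul_iff_of_root Ω hl).2 ⟨hg, rfl⟩⟩
    exact congrArg WithLp.snd h

theorem exists_hilbertBasis_laplacianInv_sq :
    ∃ (e : HilbertBasis ℕ ℝ (L2 Ω)) (μ : ℕ → ℝ), (∀ n, 0 < μ n) ∧ Antitone μ ∧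
      Tendsto μ atTop (𝓝 0) ∧ ∀ n, (laplacianInv Ω ∘L laplacianInv Ω) (e n) = μ n • e n := by
  have hsymm := laplacianInv_isSymmetric Ω
  refine exists_hilbertBasis_nat_antitone
    ((isCompactOperator_laplacianInv Ω).clm_comp (laplacianInv Ω)) (fun f g => ?_)
    (fun f hf => ?_) (not_finiteDimensional_L2 Ω)
  · exact (hsymm _ _).trans (hsymm _ _)
  · have h : ⟪laplacianInv Ω (laplacianInv Ω f), f⟫_ℝ = ⟪laplacianInv Ω f, laplacianInv Ω f⟫_ℝ :=
      hsymm _ _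
    change 0 < ⟪laplacianInv Ω (laplacianInv Ω f), f⟫_ℝ
    rw [h]
    exact real_inner_self_pos.2 fun h0 => hf (eq_zero_of_laplacianInv_eq_zero Ω h0)

/-- The only accumulation point of a convergent sequence that avoids its limit is the limit. -/
theorem accPt_range_iff_of_tendsto {a : ℕ → ℝ} {L : ℝ} (ha : Tendsto a atTop (𝓝 L))
    (hne : ∀ n, a n ≠ L) {x : ℝ} : AccPt x (𝓟 (Set.range a)) ↔ x = L := by
  rw [accPt_iff_frequently]
  constructor
  · intro h
    by_contra hx
    obtain ⟨U, V, hU, hV, hxU, hLV, hUV⟩ := t2_separation hx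
    obtain ⟨N, hN⟩ := eventually_atTop.1 (ha.eventually (hV.mem_nhds hLV))
    -- near `x` there are only the finitely many values `a n` with `n < N`
    have hF : ((a '' Set.Iio N) \ {x}).Finite := ((Set.finite_Iio N).image a).subset
      Set.sdiff_subset
    have hev : ∀ᶠ y in 𝓝 x, y ∉ (a '' Set.Iio N) \ {x} :=
      hF.isClosed.isOpen_compl.mem_nhds fun hmem => hmem.2 rfl
    have hevU : ∀ᶠ y in 𝓝 x, y ∈ U := hU.mem_nhds hxU
    obtain ⟨_, ⟨hyx, n, rfl⟩, hyU, hyF⟩ := (h.and_eventually (hevU.and hev)).exists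
    refine hyF ⟨⟨n, ?_, rfl⟩, hyx⟩
    by_contra hn
    exact Set.disjoint_left.1 hUV hyU (hN n (not_lt.1 hn))
  · rintro rfl
    exact ha.frequently (Frequently.of_forall fun n => ⟨hne n, n, rfl⟩)

end Eigenpairs

end PoissonSource

theorem mainTheorem2 {d : ℕ} [NeZero d] (Ω : BoundedOpenSet d) :
    -- the block form of the transformed operator
    (∀ f g : L2 Ω,
      transformedOperator Ω (WithLp.toLp 2 (f, g)) =
        WithLp.toLp 2
          (f + laplacianInv Ω (laplacianInv Ω f) - g, -f + g)) ∧
    -- its eigenvalues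
    (∀ l : ℝ, IsEigenvalue (transformedOperator Ω) l ↔
      ∃ μ : ℝ, IsEigenvalue
          (laplacianInv Ω ∘L laplacianInv Ω) μ ∧
        (l = upperRoot μ ∨ l = lowerRoot μ)) ∧
    -- and eigenspaces
    (∀ μ : ℝ, IsEigenvalue
        (laplacianInv Ω ∘L laplacianInv Ω) μ →
      ∀ l : ℝ, (l = upperRoot μ ∨ l = lowerRoot μ) →
        ∀ f g : L2 Ω,
          transformedOperator Ω (WithLp.toLp 2 (f, g)) =
              l • WithLp.toLp 2 (f, g) ↔
            laplacianInv Ω (laplacianInv Ω g) = μ • g ∧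
              f = (1 - l) • g) ∧
    -- the operator of the reduced problem
    ContinuousLinearMap.adjoint (reducedOperator Ω) ∘L
        reducedOperator Ω =
      laplacianInv Ω ∘L laplacianInv Ω ∧
    -- the two sequences of eigenvalues, repeated according to multiplicity
    (∃ (e : HilbertBasis ℕ ℝ (L2 Ω)) (μ : ℕ → ℝ),
      (∀ n, 0 < μ n) ∧ Antitone μ ∧ Tendsto μ atTop (𝓝 0) ∧
      (∀ n, laplacianInv Ω (laplacianInv Ω (e n)) = μ n • e n) ∧
      Tendsto (fun n => lowerRoot (μ n)) atTop (𝓝 0) ∧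
      Tendsto (fun n => lowerRoot (μ n) / μ n) atTop (𝓝 (1 / 2)) ∧
      Tendsto (fun n => upperRoot (μ n)) atTop (𝓝 2) ∧
      Tendsto (fun n => (upperRoot (μ n) - 2) / μ n) atTop (𝓝 (1 / 2))) ∧
    -- the accumulation points of the set of eigenvalues
    (∀ x : ℝ, AccPt x (𝓟 {l | IsEigenvalue
        (transformedOperator Ω) l}) ↔ x = 0 ∨ x = 2) := by
  obtain ⟨e, μ, hpos, hanti, hlim, he⟩ := exists_hilbertBasis_laplacianInv_sq Ω
  have hsymm := laplacianInv_isSymmetric Ω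
  have hne : ∀ n, μ n ≠ 0 := fun n => (hpos n).ne'
  have hset : {l | IsEigenvalue (transformedOperator Ω) l} =
      Set.range (fun n => lowerRoot (μ n)) ∪ Set.range (fun n => upperRoot (μ n)) := by
    ext l
    have hrange := isEigenvalue_iff_mem_range (T := laplacianInv Ω ∘L laplacianInv Ω)
      (fun f g => (hsymm _ _).trans (hsymm _ _)) e he
    simp only [Set.mem_ofPred_eq, isEigenvalue_transformedOperator_iff, hrange, Set.mem_union,
      Set.mem_range]
    constructor
    · rintro ⟨_, ⟨n, rfl⟩, h | h⟩
      · exact Or.inr ⟨n, h.symm⟩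
      · exact Or.inl ⟨n, h.symm⟩
    · rintro (⟨n, rfl⟩ | ⟨n, rfl⟩)
      · exact ⟨_, ⟨n, rfl⟩, Or.inr rfl⟩
      · exact ⟨_, ⟨n, rfl⟩, Or.inl rfl⟩
  refine ⟨transformedOperator_apply Ω, fun l => isEigenvalue_transformedOperator_iff Ω,
    fun μ _ l hl f g => transformedOperator_eq_smul_iff_of_root Ω hl, ?_,
    ⟨e, μ, hpos, hanti, hlim, he, tendsto_lowerRoot hlim, tendsto_lowerRoot_div hlim hne,
      tendsto_upperRoot hlim, tendsto_upperRoot_sub_two_div hlim hne⟩, fun x => ?_⟩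
  · -- the reduced operator is `A⁻¹`, which is self-adjoint
    exact congrArg (· ∘L laplacianInv Ω) (adjoint_laplacianInv Ω)
  · rw [hset, ← sup_principal, accPt_sup,
      accPt_range_iff_of_tendsto (tendsto_lowerRoot hlim) fun n => lowerRoot_ne_zero (hne n),
      accPt_range_iff_of_tendsto (tendsto_upperRoot hlim) fun n => upperRoot_ne_two (hne n)]
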